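/- Let $\Omega$ be a finite set of cardinality $d\ge 3$, let $\mathcal T_d$ be a $d$-regular tree with vertex set $V$, and fix a coloring $c$ of its (non-oriented) edges by $\Omega$ which for every vertex $v$ restricts to a bijection $c_v$ from the set $E(v)$ of edges containing $v$ onto $\Omega$. For $g\in\mathrm{Aut}(\mathcal T_d)$ and $v\in V$ let $g_v:E(v)\to E(gv)$ be the bijection induced by $g$ and let $\sigma(g,v)=c_{gv}\circ g_v\circ c_v^{-1}\in\mathrm{Sym}(\Omega)$ be the local permutation of $g$ at $v$. For permutation groups $F\le F'\le\mathrm{Sym}(\Omega)$ let $$G(F,F')=\{g\in\mathrm{Aut}(\mathcal T_d)\,:\,\sigma(g,v)\in F'\text{ for all }v\in V,\ \sigma(g,v)\in F\text{ for all but finitely many }v\in V\}.$$ **Theorem.** Let $F\le F'\le\mathrm{Sym}(\Omega)$ be permutation groups such that (a) $F$ acts simply transitively on $\Omega$; (b) $F'$ is generated by the derived subgroups $[F'_a,F'_a]$ of its point stabilizers $F'_a$, $a\in\Omega$. Then $G(F,F')$ has a subgroup of index two that is simple, finitely generated and of asymptotic dimension one (for the word metric of any finite generating set). Moreover, there exist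 infinitely many isomorphism classes of groups generated by four elements and having these properties: there is an infinite sequence of pairwise non-isomorphic groups, each of which is generated by four elements, is simple and of asymptotic dimension one, and is a subgroup of index two in a group $G(F,F')$, for some degree $d\ge 3$ and some permutation groups $F\le F'$ of degree $d$ satisfying (a) and (b). Here a metric space $X$ has asymptotic dimension at most $n$ if for every $r>0$ there are $n+1$ uniformly bounded families of subsets of $X$ which together cover $X$, such that any two distinct members $A,B$ of the same family satisfy $d(a,b)\ge r$ for all $a\in A$, $b\in B$; the asymptotic dimension of $X$ is the smallest such $n$. -/

import Mathlib

/-! ### Legal colorings of a tree and local permutations -/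

section LocalAction

variable {V Ω : Type*} {T : SimpleGraph V}

/-- A coloring of the (non-oriented) edges of `T` by `Ω` which, for every vertex `v`, restricts to
a bijection from the set of edges containing `v` to `Ω`. In particular every vertex of `T` has
degree the cardinality of `Ω`. -/
structure LegalColoring (T : SimpleGraph V) (Ω : Type*) where
  color : T.edgeSet → Ω
  bijective_star : ∀ v : V,
    Function.Bijective fun e : T.incidenceSet v => color ⟨e.1, e.2.1⟩

/-- The bijection `c_v` from the set of edges containing `v` to the set of colors. -/
noncomputable def LegalColoring.star (c : LegalColoring T Ω) (v : V) : T.incidenceSet v ≃ Ω :=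
  Equiv.ofBijective _ (c.bijective_star v)

/-- The bijection `g_v` from the edges containing `v` to the edges containing `g v` induced by
an automorphism `g`. -/
noncomputable def starMap (g : T ≃g T) (v : V) : T.incidenceSet v ≃ T.incidenceSet (g v) :=
  Equiv.ofBijective
    (fun e => ⟨(g.mapEdgeSet ⟨e.1, e.2.1⟩).1, (g.mapEdgeSet ⟨e.1, e.2.1⟩).2,
      Sym2.mem_map.2 ⟨v, e.2.2, rfl⟩⟩)
    (by
      constructor
      · intro e f h
        have h' : Sym2.map g e.1 = Sym2.map g f.1 := congrArg Subtype.val h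
        exact Subtype.ext (Sym2.map.injective g.injective h')
      · rintro ⟨f, hf, hv⟩
        obtain ⟨⟨e, he⟩, hef⟩ := g.mapEdgeSet.surjective ⟨f, hf⟩
        have hfe : Sym2.map g e = f := congrArg Subtype.val hef
        refine ⟨⟨e, he, ?_⟩, Subtype.ext hfe⟩
        rw [← hfe] at hv
        obtain ⟨w, hw, hwv⟩ := Sym2.mem_map.1 hv
        rwa [← g.injective hwv])

/-- The local permutation `σ(g, v) = c_{gv} ∘ g_v ∘ c_v⁻¹` of an automorphism `g` of `T` at the
vertex `v`. -/
noncomputable def localPerm (c : LegalColoring T Ω) (g : T ≃g T) (v : V) : Equiv.Perm Ω :=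
  (c.star v).symm.trans ((starMap g v).trans (c.star (g v)))

theorem localPerm_color (c : LegalColoring T Ω) (g : T ≃g T) (v : V) (e : T.edgeSet)
    (hv : v ∈ e.1) : localPerm c g v (c.color e) = c.color (g.mapEdgeSet e) := by
  have h : (c.star v).symm (c.color e) = ⟨e.1, e.2, hv⟩ := by
    rw [Equiv.symm_apply_eq]
    rfl
  simp only [localPerm, Equiv.trans_apply, h]
  rfl

theorem LegalColoring.exists_edge (c : LegalColoring T Ω) (v : V) (a : Ω) :
    ∃ e : T.edgeSet, v ∈ e.1 ∧ c.color e = a := by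
  obtain ⟨e, he⟩ := (c.bijective_star v).2 a
  exact ⟨⟨e.1, e.2.1⟩, e.2.2, he⟩

theorem localPerm_one (c : LegalColoring T Ω) (v : V) : localPerm c 1 v = 1 := by
  ext a
  obtain ⟨e, hv, rfl⟩ := c.exists_edge v a
  rw [localPerm_color c 1 v e hv]
  have : (1 : T ≃g T).mapEdgeSet e = e := Subtype.ext (congrFun Sym2.map_id e.1)
  rw [this]
  rfl

theorem localPerm_mul (c : LegalColoring T Ω) (g h : T ≃g T) (v : V) :
    localPerm c (g * h) v = localPerm c g (h v) * localPerm c h v := by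
  ext a
  obtain ⟨e, hv, rfl⟩ := c.exists_edge v a
  rw [Equiv.Perm.mul_apply, localPerm_color c h v e hv, localPerm_color c (g * h) v e hv,
    localPerm_color c g (h v) (h.mapEdgeSet e) (Sym2.mem_map.2 ⟨v, hv, rfl⟩)]
  congr 1
  exact Subtype.ext (Sym2.map_map (g := g) (f := h) e.1).symm

theorem localPerm_inv (c : LegalColoring T Ω) (g : T ≃g T) (v : V) :
    localPerm c g⁻¹ v = (localPerm c g (g⁻¹ v))⁻¹ := by
  have h := localPerm_mul c g g⁻¹ v
  rw [mul_inv_cancel, localPerm_one] at h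
  exact eq_inv_of_mul_eq_one_right h.symm

/-- The Burger–Mozes group `U(F)`: all local permutations belong to `F`. -/
def universalGroup (c : LegalColoring T Ω) (F : Subgroup (Equiv.Perm Ω)) : Subgroup (T ≃g T) where
  carrier := {g | ∀ v, localPerm c g v ∈ F}
  one_mem' v := by rw [localPerm_one]; exact F.one_mem
  mul_mem' {g h} hg hh v := by rw [localPerm_mul]; exact F.mul_mem (hg _) (hh _)
  inv_mem' {g} hg v := by rw [localPerm_inv]; exact F.inv_mem (hg _)

/-- The group `G(F)`: the local permutations belong to `F` for all but finitely many vertices. -/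
def almostPrescribedGroup (c : LegalColoring T Ω) (F : Subgroup (Equiv.Perm Ω)) :
    Subgroup (T ≃g T) where
  carrier := {g | {v | localPerm c g v ∉ F}.Finite}
  one_mem' := by
    simp only [Set.mem_ofPred_eq, localPerm_one, F.one_mem, not_true_eq_false, Set.ofPred_false,
      Set.finite_empty]
  mul_mem' {g h} hg hh := by
    have hg' : {v | localPerm c g (h v) ∉ F}.Finite :=
      Set.Finite.preimage (f := h) h.injective.injOn hg
    refine (hg'.union hh).subset fun v hv => ?_
    by_contra hcon
    simp only [Set.mem_union, Set.mem_ofPred_eq, not_or, not_not] at hcon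
    exact hv (by rw [localPerm_mul]; exact F.mul_mem hcon.1 hcon.2)
  inv_mem' {g} hg := by
    have hg' : {v | localPerm c g (g⁻¹ v) ∉ F}.Finite :=
      Set.Finite.preimage (f := (g⁻¹ : T ≃g T)) (g⁻¹ : T ≃g T).injective.injOn hg
    refine hg'.subset fun v hv => ?_
    intro hcon
    exact hv (by rw [localPerm_inv]; exact F.inv_mem hcon)

/-- The group `G(F, F') = G(F) ∩ U(F')`. -/
def restrictedUniversalGroup (c : LegalColoring T Ω) (F F' : Subgroup (Equiv.Perm Ω)) :
    Subgroup (T ≃g T) :=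
  almostPrescribedGroup c F ⊓ universalGroup c F'

end LocalAction

/-! ### Permutation groups -/

section PermutationGroups

variable {Ω : Type*}

/-- `F` acts simply transitively on `Ω`. -/
def SimplyTransitive (F : Subgroup (Equiv.Perm Ω)) : Prop :=
  ∀ a b : Ω, ∃! σ : Equiv.Perm Ω, σ ∈ F ∧ σ a = b

/-- The stabilizer of the point `a` in the permutation group `F`. -/
def pointStabilizer (F : Subgroup (Equiv.Perm Ω)) (a : Ω) : Subgroup (Equiv.Perm Ω) :=
  F ⊓ MulAction.stabilizer (Equiv.Perm Ω) a

/-- `F` is generated by the derived subgroups of its point stabilizers. -/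
def GeneratedByDerivedStabilizers (F : Subgroup (Equiv.Perm Ω)) : Prop :=
  F = ⨆ a : Ω, ⁅pointStabilizer F a, pointStabilizer F a⁆

end PermutationGroups

/-! ### Asymptotic dimension -/

section AsymptoticDimension

/-- The metric space `X` has asymptotic dimension at most `n`: for every `r > 0` there are `n + 1`
uniformly bounded families of pairwise `r`-disjoint subsets which together cover `X`. -/
def AsdimLE (X : Type*) [MetricSpace X] (n : ℕ) : Prop :=
  ∀ r : ℝ, 0 < r → ∃ 𝓤 : Fin (n + 1) → Set (Set X),
    (∀ i, ∀ A ∈ 𝓤 i, ∀ B ∈ 𝓤 i, A ≠ B → ∀ a ∈ A, ∀ b ∈ B, r ≤ dist a b) ∧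
    (∃ C : ℝ, ∀ i, ∀ A ∈ 𝓤 i, ∀ x ∈ A, ∀ y ∈ A, dist x y ≤ C) ∧
    (∀ x : X, ∃ i, ∃ A ∈ 𝓤 i, x ∈ A)

/-- The asymptotic dimension of a metric space (`⊤` if it is not finite). -/
noncomputable def asdim (X : Type*) [MetricSpace X] : ℕ∞ :=
  sInf {m : ℕ∞ | ∃ n : ℕ, m = n ∧ AsdimLE X n}

theorem mulCayley_connected {G : Type*} [Group G] {S : Set G} (hS : Subgroup.closure S = ⊤) :
    (SimpleGraph.mulCayley S).Connected := by
  have step : ∀ u s : G, s ∈ S → (SimpleGraph.mulCayley S).Reachable u (u * s) := by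
    intro u s hs
    by_cases h : u = u * s
    · rw [← h]
    · exact SimpleGraph.Adj.reachable
        ((SimpleGraph.mulCayley_adj' S _ _).2 ⟨h, s, hs, Or.inl rfl⟩)
  have key : ∀ g : G, ∀ u : G, (SimpleGraph.mulCayley S).Reachable u (u * g) := by
    intro g
    have hg : g ∈ Subgroup.closure S := by rw [hS]; trivial
    induction hg using Subgroup.closure_induction with
    | mem s hs => exact fun u => step u s hs
    | one => intro u; rw [mul_one]
    | mul x y _ _ hx hy =>
      intro u
      rw [← mul_assoc]
      exact (hx u).trans (hy (u * x))
    | inv x _ hx =>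
      intro u
      have := (hx (u * x⁻¹)).symm
      rwa [inv_mul_cancel_right] at this
  have : Nonempty G := ⟨1⟩
  refine ⟨fun u v => ?_⟩
  have := key (u⁻¹ * v) u
  rwa [mul_inv_cancel_left] at this

/-- The word metric on `G` associated with a generating set `S`: the path metric of the Cayley
graph of `G` with respect to `S`. -/
@[reducible]
noncomputable def wordMetric {G : Type*} [Group G] (S : Set G) (hS : Subgroup.closure S = ⊤) :
    MetricSpace G where
  dist g h := ((SimpleGraph.mulCayley S).dist g h : ℝ)
  dist_self g := by simp
  dist_comm g h := by rw [SimpleGraph.dist_comm]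
  dist_triangle g h k := by exact_mod_cast (mulCayley_connected hS).dist_triangle
  eq_of_dist_eq_zero {g h} hgh := by
    exact (mulCayley_connected hS).dist_eq_zero_iff.1 (by exact_mod_cast hgh)

/-- The finitely generated group `G` has asymptotic dimension `n`, for the word metric of any
finite generating set. -/
def GroupHasAsdim (G : Type*) [Group G] (n : ℕ∞) : Prop :=
  Group.FG G ∧ ∀ (S : Set G) (_ : S.Finite) (hS : Subgroup.closure S = ⊤),
    @asdim G (wordMetric S hS) = n

end AsymptoticDimension

/-! ### Neighbours by color and reduced words -/

section Words

variable {V Ω : Type*} {T : SimpleGraph V} (c : LegalColoring T Ω)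

namespace LegalColoring

/-! Vertices are coded by reduced words in the colors, and the subgroup of index two consists of the
type-preserving elements, the kernel of the parity of displacement (`typeHom`).

Since `F` acts freely and transitively, one vertex, its image and a local permutation there extend
to an automorphism whose other local permutations lie in `F` (`exists_lift`), and such data at the
singularities determine an automorphism (`iso_ext_of_local`). Hence each `vertexGroup` is a copy of
`F'`. Correcting singularities one by one and folding even paths shows that these copies generate
the type-preserving group; two of them, at adjacent vertices, suffice
(`typePreservingGroup_eq_closure`). If two permutations generate `F'`, this gives four generators.

Simplicity is a double commutator argument. A vertex automorphism fixing an edge at its vertex is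
supported on a half-tree. A nontrivial normal subgroup displaces every half-tree from itself
(`exists_mem_displacing`), so it contains all commutators of elements supported on a common
half-tree (`commutator_mem`); hypothesis (b) says that these fill every vertex group.

For asymptotic dimension at most one (`asdimLE_one`), cut the tree into annuli around `v`, pull them
back by the orbit map, and take the components at scale `r` of the even and of the odd annuli. Along
a component both displacement and singularities remain in a ball of fixed radius, which leaves
finitely many automorphisms. An infinite finitely generated group does not have dimension zero.

For infinitely many groups, take translations inside the alternating group in prime degree. Degree
`q` produces an element of order `q`, whereas a smaller degree admits none: an automorphism of odd
order fixes a vertex (`exists_fixed_vertex`), and `q` does not divide the orders of its local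
permutations. -/

theorem exists_adj_color (v : V) (a : Ω) : ∃ w, ∃ h : T.Adj v w, c.color ⟨s(v, w), h⟩ = a := by
  obtain ⟨⟨e, he⟩, hv, ha⟩ := c.exists_edge v a
  obtain ⟨w, rfl⟩ := Sym2.mem_iff_exists.1 hv
  exact ⟨w, he, ha⟩

/-- The neighbour of `v` along the edge of color `a`. -/
noncomputable def nb (v : V) (a : Ω) : V := (c.exists_adj_color v a).choose

theorem nb_adj (v : V) (a : Ω) : T.Adj v (c.nb v a) := (c.exists_adj_color v a).choose_spec.choose

theorem color_nb (v : V) (a : Ω) : c.color ⟨s(v, c.nb v a), c.nb_adj v a⟩ = a :=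
  (c.exists_adj_color v a).choose_spec.choose_spec

theorem eq_nb {v w : V} (h : T.Adj v w) : w = c.nb v (c.color ⟨s(v, w), h⟩) := by
  have h1 := c.color_nb v (c.color ⟨s(v, w), h⟩)
  have h2 := (c.bijective_star v).1
    (a₁ := ⟨s(v, c.nb v (c.color ⟨s(v, w), h⟩)), c.nb_adj v _, Sym2.mem_mk_left _ _⟩)
    (a₂ := ⟨s(v, w), h, Sym2.mem_mk_left _ _⟩) h1
  have h3 : s(v, c.nb v (c.color ⟨s(v, w), h⟩)) = s(v, w) := congrArg Subtype.val h2
  exact (Sym2.congr_right.1 h3).symm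

theorem exists_eq_nb {v w : V} (h : T.Adj v w) : ∃ a, w = c.nb v a := ⟨_, c.eq_nb h⟩

theorem nb_injective (v : V) : Function.Injective (c.nb v) := by
  intro a b h
  have ha := c.color_nb v a
  have hb := c.color_nb v b
  rw [← ha, ← hb]
  congr 1
  exact Subtype.ext (by simp only [h])

@[simp] theorem nb_nb (v : V) (a : Ω) : c.nb (c.nb v a) a = v := by
  have h := c.eq_nb (c.nb_adj v a).symm
  have h2 : c.color ⟨s(c.nb v a, v), (c.nb_adj v a).symm⟩ = a := by
    rw [← c.color_nb v a]
    congr 1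
    exact Subtype.ext (by simp only [c.color_nb]; exact Sym2.eq_swap)
  rw [h2] at h
  exact h.symm

theorem map_nb (g : T ≃g T) (v : V) (a : Ω) : g (c.nb v a) = c.nb (g v) (localPerm c g v a) := by
  have h := localPerm_color c g v ⟨s(v, c.nb v a), c.nb_adj v a⟩ (Sym2.mem_mk_left _ _)
  rw [c.color_nb] at h
  rw [h]
  exact c.eq_nb (g.map_rel_iff.2 (c.nb_adj v a))

theorem localPerm_eq_of_map_nb {g : T ≃g T} {v : V} {s : Equiv.Perm Ω}
    (h : ∀ a, g (c.nb v a) = c.nb (g v) (s a)) : localPerm c g v = s := by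
  ext a
  apply c.nb_injective (g v)
  rw [← c.map_nb, h]

/-- The two endpoints of an edge see the same color on its image. This compatibility is the only
constraint linking neighbouring local permutations. -/
theorem localPerm_nb (g : T ≃g T) (v : V) (a : Ω) :
    localPerm c g (c.nb v a) a = localPerm c g v a := by
  apply c.nb_injective (g (c.nb v a))
  rw [← c.map_nb, nb_nb, c.map_nb g v a, nb_nb]

/-- The end of the path starting at `v` along the edges of the successive colors of `l`. -/
noncomputable def act (v : V) (l : List Ω) : V := l.foldl c.nb v

@[simp] theorem act_nil (v : V) : c.act v [] = v := rfl

@[simp] theorem act_cons (v : V) (a : Ω) (l : List Ω) : c.act v (a :: l) = c.act (c.nb v a) l := rfl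

theorem act_append (v : V) (l m : List Ω) : c.act v (l ++ m) = c.act (c.act v l) m :=
  List.foldl_append

theorem act_concat (v : V) (l : List Ω) (a : Ω) : c.act v (l ++ [a]) = c.nb (c.act v l) a := by
  rw [act_append]; rfl

@[simp] theorem act_act_reverse (v : V) (l : List Ω) : c.act (c.act v l) l.reverse = v := by
  induction l generalizing v with
  | nil => rfl
  | cons a l ih => rw [List.reverse_cons, act_concat, act_cons, ih, nb_nb]

/-- The walk along the edges of the successive colors of `l`. -/
noncomputable def wordWalk : (v : V) → (l : List Ω) → T.Walk v (c.act v l)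
  | _, [] => .nil
  | v, a :: l => .cons (c.nb_adj v a) (wordWalk (c.nb v a) l)

theorem wordWalk_edges_isChain (v : V) (l : List Ω) (hl : l.IsChain (· ≠ ·)) :
    (c.wordWalk v l).edges.IsChain (· ≠ ·) := by
  induction l generalizing v with
  | nil => exact List.isChain_nil
  | cons a l ih =>
    cases l with
    | nil => exact List.isChain_singleton _
    | cons b l =>
      obtain ⟨hab, hl⟩ := List.isChain_cons_cons.1 hl
      have := ih (c.nb v a) hl
      simp only [wordWalk] at this ⊢
      refine List.isChain_cons_cons.2 ⟨fun h => hab ?_, this⟩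
      replace h : s(v, c.nb v a) = s(c.nb v a, c.nb (c.nb v a) b) := h
      rw [Sym2.eq_swap] at h
      have h2 := Sym2.congr_right.1 h
      apply c.nb_injective (c.nb v a)
      rw [nb_nb, ← h2]

/-- Distinct consecutive colors mean distinct consecutive edges, and a walk without backtracking in
an acyclic graph is a path. -/
theorem act_ne_self (hT : T.IsAcyclic) {v : V} {l : List Ω} (hl : l.IsChain (· ≠ ·))
    (h0 : l ≠ []) : c.act v l ≠ v := by
  intro h
  have hp := (hT.isPath_iff_isChain _).2 (c.wordWalk_edges_isChain v l hl)
  cases l with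
  | nil => exact h0 rfl
  | cons a l =>
    apply ((SimpleGraph.Walk.cons_isPath_iff _ _).1 hp).2
    have h3 := SimpleGraph.Walk.end_mem_support (c.wordWalk (c.nb v a) l)
    exact (congrArg (· ∈ (c.wordWalk (c.nb v a) l).support) h).mp h3

theorem act_injOn (hT : T.IsAcyclic) {v : V} {l m : List Ω} (hl : l.IsChain (· ≠ ·))
    (hm : m.IsChain (· ≠ ·)) (h : c.act v l = c.act v m) : l = m := by
  induction l generalizing v m with
  | nil =>
    by_contra h0
    exact c.act_ne_self hT hm (Ne.symm h0) h.symm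
  | cons a l ih =>
    cases m with
    | nil => exact absurd h (c.act_ne_self hT hl (by simp))
    | cons b m =>
      by_cases hab : a = b
      · subst hab
        rw [ih hl.tail (m := m) hm.tail h]
      · exfalso
        -- If the first letters differ, going back along the first word and out along the second is
        -- a nonempty reduced loop.
        refine c.act_ne_self hT (v := c.act v (a :: l)) (l := (a :: l).reverse ++ (b :: m)) ?_
          (by simp) ?_
        · refine List.isChain_append.2 ⟨?_, hm, ?_⟩
          · rw [List.isChain_reverse]
            exact hl.imp fun _ _ h => h.symm
          · simpa using hab
        · rw [act_append, act_act_reverse, h]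

theorem induction_nb (hT : T.Connected) (v : V) {P : V → Prop} (h0 : P v)
    (h : ∀ u a, P u → P (c.nb u a)) (u : V) : P u := by
  obtain ⟨p⟩ := hT.preconnected v u
  induction p with
  | nil => exact h0
  | cons hadj _ ih =>
    obtain ⟨a, rfl⟩ := c.exists_eq_nb hadj
    exact ih (h _ _ h0)

theorem exists_reduced (hT : T.Connected) (v u : V) :
    ∃ l : List Ω, l.IsChain (· ≠ ·) ∧ c.act v l = u := by
  induction u using c.induction_nb hT v with
  | h0 => exact ⟨[], List.isChain_nil, rfl⟩
  | h u a ih =>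
    obtain ⟨l, hl, rfl⟩ := ih
    rcases List.eq_nil_or_concat' l with rfl | ⟨m, b, rfl⟩
    · exact ⟨[a], List.isChain_singleton _, rfl⟩
    · by_cases hab : b = a
      · subst hab
        exact ⟨m, hl.left_of_append, by rw [act_concat, nb_nb]⟩
      · exact ⟨m ++ [b] ++ [a], List.isChain_append.2 ⟨hl, List.isChain_singleton _, by simpa⟩,
          c.act_concat _ _ _⟩

open Classical in
/-- The reduced word leading from `v` to `u` (if there is one). -/
noncomputable def wd (v u : V) : List Ω :=
  if h : ∃ l : List Ω, l.IsChain (· ≠ ·) ∧ c.act v l = u then h.choose else []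

variable {c}

theorem wd_isChain (hT : T.IsTree) (v u : V) : (c.wd v u).IsChain (· ≠ ·) := by
  have h := c.exists_reduced hT.connected v u
  rw [wd, dif_pos h]; exact h.choose_spec.1

theorem act_wd (hT : T.IsTree) (v u : V) : c.act v (c.wd v u) = u := by
  have h := c.exists_reduced hT.connected v u
  rw [wd, dif_pos h]; exact h.choose_spec.2

theorem wd_act (hT : T.IsTree) (v : V) {l : List Ω} (hl : l.IsChain (· ≠ ·)) :
    c.wd v (c.act v l) = l :=
  c.act_injOn hT.isAcyclic (wd_isChain hT _ _) hl (act_wd hT _ _)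

theorem wd_eq (hT : T.IsTree) {v u : V} {l : List Ω} (hl : l.IsChain (· ≠ ·))
    (h : c.act v l = u) : c.wd v u = l := by
  rw [← h, wd_act hT v hl]

@[simp] theorem wd_self (hT : T.IsTree) (v : V) : c.wd v v = [] :=
  wd_eq hT List.isChain_nil rfl

theorem wd_eq_nil (hT : T.IsTree) {v u : V} : c.wd v u = [] ↔ u = v := by
  refine ⟨fun h => ?_, fun h => h ▸ wd_self hT u⟩
  rw [← act_wd (c := c) hT v u, h, act_nil]

theorem wd_symm (hT : T.IsTree) (v u : V) : c.wd u v = (c.wd v u).reverse := by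
  refine wd_eq hT ?_ ?_
  · rw [List.isChain_reverse]
    exact (wd_isChain hT v u).imp fun _ _ h => h.symm
  · have h := c.act_act_reverse v (c.wd v u)
    rwa [act_wd hT] at h

/-- Passing to a neighbour either removes the last letter of the reduced word or appends one. -/
theorem wd_nb (hT : T.IsTree) (v u : V) (a : Ω) :
    c.wd v u = c.wd v (c.nb u a) ++ [a] ∨ c.wd v (c.nb u a) = c.wd v u ++ [a] := by
  have hc := wd_isChain (c := c) hT v u
  have hu := act_wd (c := c) hT v u
  rcases List.eq_nil_or_concat' (c.wd v u) with h | ⟨m, b, h⟩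
  · right
    rw [h] at hu ⊢
    refine wd_eq hT (List.isChain_singleton _) ?_
    rw [← hu]; rfl
  · by_cases hab : b = a
    · subst hab
      left
      rw [h, List.append_cancel_right_eq]
      rw [h] at hu hc
      rw [wd_eq hT hc.left_of_append]
      rw [← hu, act_concat, nb_nb]
    · right
      refine wd_eq hT ?_ (by rw [act_concat, hu])
      refine List.isChain_append.2 ⟨hc, List.isChain_singleton _, ?_⟩
      rw [h]; simpa

/-- Passing to a neighbour of the initial vertex either removes the first letter of the reduced
word or prepends one. -/
theorem wd_nb_left (hT : T.IsTree) (v u : V) (a : Ω) :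
    c.wd v u = a :: c.wd (c.nb v a) u ∨
      (c.wd (c.nb v a) u = a :: c.wd v u ∧ (c.wd v u).head? ≠ some a) := by
  have hr := wd_isChain (c := c) hT (c.nb v a) u
  rcases wd_nb (c := c) hT u v a with h | h <;>
    rw [wd_symm hT v u, wd_symm hT (c.nb v a) u, ← List.reverse_inj] at h <;> 
    simp only [List.reverse_reverse, List.reverse_append, List.reverse_cons, List.reverse_nil,
      List.nil_append, List.singleton_append] at h
  · exact Or.inl h
  · refine Or.inr ⟨h, fun h2 => ?_⟩
    rw [h] at hr
    cases hw : c.wd v u with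
    | nil => simp [hw] at h2
    | cons b t =>
      rw [hw] at hr h2
      exact (List.isChain_cons_cons.1 hr).1 (by simpa using h2.symm)

end LegalColoring

end Words

/-! ### Automorphisms and local data -/

section Automorphisms

variable {V Ω : Type*} {T : SimpleGraph V} {c : LegalColoring T Ω}

open LegalColoring

/-- Reducedness survives because `s u` and `s (c.nb u a)` agree at `a`: the image path backtracks
only if the original does. -/
theorem exists_word_of_local {φ : V → V} {s : V → Equiv.Perm Ω}
    (h : ∀ u a, φ (c.nb u a) = c.nb (φ u) (s u a)) (u : V) (l : List Ω) :
    ∃ l' : List Ω, l'.length = l.length ∧ φ (c.act u l) = c.act (φ u) l' ∧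
      (l.IsChain (· ≠ ·) → l'.IsChain (· ≠ ·)) ∧ l'.head? = l.head?.map (s u) := by
  induction l generalizing u with
  | nil => exact ⟨[], rfl, rfl, fun h => h, rfl⟩
  | cons a l ih =>
    obtain ⟨l', hlen, hact, hch, hhd⟩ := ih (c.nb u a)
    refine ⟨s u a :: l', by simp [hlen], by simp [hact, h], fun hl => ?_, rfl⟩
    refine List.isChain_cons.2 ⟨?_, hch hl.tail⟩
    intro y hy
    rw [hhd] at hy
    obtain ⟨b, hb, rfl⟩ := Option.map_eq_some_iff.1 hy
    have hab : a ≠ b := (List.isChain_cons.1 hl).1 b hb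
    have hs : s (c.nb u a) a = s u a := by
      apply c.nb_injective (φ (c.nb u a))
      rw [← h, nb_nb, h u a, nb_nb]
    rw [← hs]
    exact fun h' => hab ((s (c.nb u a)).injective h')

theorem exists_word_map (g : T ≃g T) (u : V) (l : List Ω) :
    ∃ l' : List Ω, l'.length = l.length ∧ g (c.act u l) = c.act (g u) l' ∧
      (l.IsChain (· ≠ ·) → l'.IsChain (· ≠ ·)) ∧ l'.head? = l.head?.map (localPerm c g u) :=
  exists_word_of_local (c.map_nb g) u l

theorem head?_wd_map (hT : T.IsTree) (g : T ≃g T) (u w : V) :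
    (c.wd (g u) (g w)).head? = (c.wd u w).head?.map (localPerm c g u) := by
  obtain ⟨l', -, h2, h3, h4⟩ := exists_word_map (c := c) g u (c.wd u w)
  rw [act_wd hT] at h2
  rw [wd_eq hT (h3 (wd_isChain hT _ _)) h2.symm, h4]

theorem length_wd_map (hT : T.IsTree) (g : T ≃g T) (u w : V) :
    (c.wd (g u) (g w)).length = (c.wd u w).length := by
  obtain ⟨l', h1, h2, h3, -⟩ := exists_word_map (c := c) g u (c.wd u w)
  rw [act_wd hT] at h2
  rw [wd_eq hT (h3 (wd_isChain hT _ _)) h2.symm, h1]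

/-- Injectivity holds because reduced words go to reduced words of the same length, which are not
loops. Surjectivity holds because the image is nonempty and closed under taking neighbours. -/
theorem exists_iso_of_local (hT : T.IsTree) {φ : V → V} {s : V → Equiv.Perm Ω}
    (h : ∀ u a, φ (c.nb u a) = c.nb (φ u) (s u a)) :
    ∃ g : T ≃g T, (∀ u, g u = φ u) ∧ ∀ u, localPerm c g u = s u := by
  obtain ⟨v⟩ := hT.connected.nonempty
  have hinj : Function.Injective φ := by
    intro u w huw
    obtain ⟨l, hl, rfl⟩ := c.exists_reduced hT.connected u w
    obtain ⟨l', hlen, hact, hch, -⟩ := exists_word_of_local h u l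
    by_contra hne
    have h0 : l ≠ [] := fun h0 => hne (by simp [h0])
    refine c.act_ne_self hT.isAcyclic (hch hl) ?_ (hact.symm.trans huw.symm)
    exact fun h1 => h0 (List.length_eq_zero_iff.1 (by rw [← hlen, h1]; rfl))
  have hsurj : Function.Surjective φ := by
    intro u
    induction u using c.induction_nb hT.connected (φ v) with
    | h0 => exact ⟨v, rfl⟩
    | h u a ih =>
      obtain ⟨w, rfl⟩ := ih
      exact ⟨c.nb w ((s w).symm a), by rw [h, Equiv.apply_symm_apply]⟩
  let g : T ≃g T :=
    { toEquiv := Equiv.ofBijective φ ⟨hinj, hsurj⟩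
      map_rel_iff' := by
        intro u w
        change T.Adj (φ u) (φ w) ↔ T.Adj u w
        constructor
        · intro ha
          obtain ⟨b, hb⟩ := c.exists_eq_nb ha
          have : w = c.nb u ((s u).symm b) := hinj (by rw [hb, h, Equiv.apply_symm_apply])
          rw [this]
          exact c.nb_adj _ _
        · intro ha
          obtain ⟨a, rfl⟩ := c.exists_eq_nb ha
          rw [h]
          exact c.nb_adj _ _ }
  exact ⟨g, fun _ => rfl, fun u => localPerm_eq_of_map_nb c fun a => h u a⟩

/-- If `F` is simply transitive, a vertex and a local permutation at this vertex can be
prescribed for an automorphism whose other local permutations belong to `F`. -/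
theorem exists_lift (hT : T.IsTree) {F : Subgroup (Equiv.Perm Ω)} (hF : SimplyTransitive F)
    (v w : V) (σ : Equiv.Perm Ω) :
    ∃ g : T ≃g T, g v = w ∧ localPerm c g v = σ ∧ ∀ u, u ≠ v → localPerm c g u ∈ F := by
  choose f hf using fun a => (hF a (σ a)).exists
  -- On the branch leaving `v` by color `a` the local permutation is constantly `f a`, the element
  -- of `F` agreeing with `σ` at `a`. This agreement is what makes the data compatible along the
  -- edge.
  let Φ : List Ω → V := fun l => match l with
    | [] => w
    | a :: t => c.act w (σ a :: t.map (f a))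
  let S : List Ω → Equiv.Perm Ω := fun l => match l with
    | [] => σ
    | a :: _ => f a
  have hΦ : ∀ l b, Φ (l ++ [b]) = c.nb (Φ l) (S l b) := by
    intro l b
    cases l with
    | nil => rfl
    | cons a t =>
      change c.act w (σ a :: (t ++ [b]).map (f a)) = _
      rw [List.map_append, ← List.cons_append, List.map_singleton, act_concat]
  have hS : ∀ l b, S (l ++ [b]) b = S l b := by
    intro l b
    cases l with
    | nil => exact (hf b).2
    | cons a t => rfl
  obtain ⟨g, hg, hg'⟩ := exists_iso_of_local hT (c := c) (φ := fun u => Φ (c.wd v u))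
    (s := fun u => S (c.wd v u)) (by
      intro u b
      rcases wd_nb (c := c) hT v u b with h | h
      · simp only [h, hΦ, hS, nb_nb]
      · simp only [h, hΦ])
  refine ⟨g, by rw [hg, wd_self hT], by rw [hg', wd_self hT], fun u hu => ?_⟩
  rw [hg']
  cases h : c.wd v u with
  | nil => exact absurd ((wd_eq_nil hT).1 h) hu
  | cons a t => exact (hf a).1

theorem SimplyTransitive.eq_of_apply_eq {F : Subgroup (Equiv.Perm Ω)} (hF : SimplyTransitive F)
    {σ τ : Equiv.Perm Ω} (hσ : σ ∈ F) (hτ : τ ∈ F) {a : Ω} (h : σ a = τ a) : σ = τ :=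
  (hF a (τ a)).unique ⟨hσ, h⟩ ⟨hτ, rfl⟩

/-- An automorphism is determined by the image of a vertex and its local permutations at this
vertex and at all singularities. -/
theorem iso_ext_of_local (hT : T.IsTree) {F : Subgroup (Equiv.Perm Ω)} (hF : SimplyTransitive F)
    {g h : T ≃g T} {v : V} (hv : g v = h v)
    (hv' : localPerm c g v = localPerm c h v)
    (hs : ∀ u, localPerm c g u = localPerm c h u ∨ (localPerm c g u ∈ F ∧ localPerm c h u ∈ F)) :
    g = h := by
  have key : ∀ u, g u = h u ∧ localPerm c g u = localPerm c h u := by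
    intro u
    induction u using c.induction_nb hT.connected v with
    | h0 => exact ⟨hv, hv'⟩
    | h u a ih =>
      refine ⟨by rw [c.map_nb, c.map_nb, ih.1, ih.2], ?_⟩
      rcases hs (c.nb u a) with h1 | ⟨h1, h2⟩
      · exact h1
      · exact hF.eq_of_apply_eq h1 h2 (a := a) (by rw [localPerm_nb, localPerm_nb, ih.2])
  exact RelIso.ext fun u => (key u).1

/-! ### The type of a vertex -/

theorem neg_one_pow_length_wd_act (hT : T.IsTree) (v u : V) (l : List Ω) :
    (-1 : ℤˣ) ^ (c.wd v (c.act u l)).length = (-1) ^ (c.wd v u).length * (-1) ^ l.length := by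
  induction l generalizing u with
  | nil => simp
  | cons a l ih =>
    rw [act_cons, ih, List.length_cons]
    rcases wd_nb (c := c) hT v u a with h | h <;> rw [h] <;> simp [pow_succ]

/-- The homomorphism whose kernel consists of the type-preserving automorphisms. -/
noncomputable def typeHom (c : LegalColoring T Ω) (hT : T.IsTree) (v : V) : (T ≃g T) →* ℤˣ where
  toFun g := (-1) ^ (c.wd v (g v)).length
  map_one' := by
    change (-1 : ℤˣ) ^ (c.wd v v).length = 1
    simp [wd_self hT]
  map_mul' g h := by
    obtain ⟨l', h1, h2, -, -⟩ := exists_word_map (c := c) g v (c.wd v (h v))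
    rw [act_wd hT] at h2
    change (-1 : ℤˣ) ^ (c.wd v (g (h v))).length = _
    rw [h2, neg_one_pow_length_wd_act hT, h1]

/-- Parity of distance is additive along paths and preserved by `g`, so the base vertex is
irrelevant; elements fixing some vertex are therefore type-preserving. -/
theorem typeHom_eq (hT : T.IsTree) (v u : V) (g : T ≃g T) :
    typeHom c hT v g = (-1) ^ (c.wd u (g u)).length := by
  obtain ⟨l', h1, h2, -, -⟩ := exists_word_map (c := c) g v (c.wd v u)
  rw [act_wd hT] at h2
  have h3 := neg_one_pow_length_wd_act (c := c) hT v (g v) l'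
  have h4 := neg_one_pow_length_wd_act (c := c) hT v u (c.wd u (g u))
  rw [act_wd hT, h2, h3, h1, mul_comm, ← h2] at h4
  exact mul_left_cancel h4

end Automorphisms

/-! ### Automorphisms with at most one singularity -/

section VertexGroups

variable {V Ω : Type*} {T : SimpleGraph V} {c : LegalColoring T Ω}
  {F F' : Subgroup (Equiv.Perm Ω)}

open LegalColoring

/-- The automorphisms fixing `v` whose local permutation at `v` belongs to `F'` and whose other
local permutations belong to `F`. -/
def vertexGroup (c : LegalColoring T Ω) (F F' : Subgroup (Equiv.Perm Ω)) (v : V) :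
    Subgroup (T ≃g T) where
  carrier := {g | g v = v ∧ localPerm c g v ∈ F' ∧ ∀ u, u ≠ v → localPerm c g u ∈ F}
  one_mem' := ⟨rfl, by rw [localPerm_one]; exact F'.one_mem,
    fun u _ => by rw [localPerm_one]; exact F.one_mem⟩
  mul_mem' {g h} hg hh := by
    refine ⟨?_, ?_, fun u hu => ?_⟩
    · rw [RelIso.mul_apply, hh.1, hg.1]
    · rw [localPerm_mul, hh.1]
      exact F'.mul_mem hg.2.1 hh.2.1
    · rw [localPerm_mul]
      refine F.mul_mem (hg.2.2 _ fun h' => hu ?_) (hh.2.2 u hu)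
      exact h.injective (h'.trans hh.1.symm)
  inv_mem' {g} hg := by
    have h1 : g⁻¹ v = v := g.injective (by rw [RelIso.apply_inv_self, hg.1])
    refine ⟨h1, ?_, fun u hu => ?_⟩
    · rw [localPerm_inv, h1]
      exact F'.inv_mem hg.2.1
    · rw [localPerm_inv]
      refine F.inv_mem (hg.2.2 _ fun h' => hu ?_)
      rw [← RelIso.apply_inv_self g u, h', hg.1]

/-- The type-preserving elements of `G(F, F')`. -/
noncomputable def typePreservingGroup (c : LegalColoring T Ω) (hT : T.IsTree)
    (F F' : Subgroup (Equiv.Perm Ω)) (v : V) : Subgroup (T ≃g T) :=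
  restrictedUniversalGroup c F F' ⊓ (typeHom c hT v).ker

theorem mem_restricted_of_mem_vertexGroup (hle : F ≤ F') {v : V} {g : T ≃g T}
    (hg : g ∈ vertexGroup c F F' v) : g ∈ restrictedUniversalGroup c F F' := by
  refine ⟨(Set.finite_singleton v).subset fun u hu => ?_, fun u => ?_⟩
  · by_contra h
    exact hu (hg.2.2 u h)
  · by_cases h : u = v
    · rw [h]; exact hg.2.1
    · exact hle (hg.2.2 u h)

theorem vertexGroup_le_typePreservingGroup (hT : T.IsTree) (hle : F ≤ F') (v u : V) :
    vertexGroup c F F' u ≤ typePreservingGroup c hT F F' v := by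
  intro g hg
  refine ⟨mem_restricted_of_mem_vertexGroup hle hg, ?_⟩
  change typeHom c hT v g = 1
  rw [typeHom_eq hT v u, hg.1, wd_self hT]
  simp

/-- The homomorphism sending an automorphism with at most one singularity `v` to its local
permutation at `v`. -/
noncomputable def vertexHom (c : LegalColoring T Ω) (F F' : Subgroup (Equiv.Perm Ω)) (v : V) :
    vertexGroup c F F' v →* Equiv.Perm Ω where
  toFun g := localPerm c g.1 v
  map_one' := localPerm_one c v
  map_mul' g h := by
    rw [Subgroup.coe_mul, localPerm_mul, h.2.1]

/-- Rigidity: away from `v` the local permutations lie in the freely acting group `F`, so they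
propagate from the one at `v`. -/
theorem vertexHom_injective (hT : T.IsTree) (hF : SimplyTransitive F) (v : V) :
    Function.Injective (vertexHom c F F' v) := by
  intro g h hgh
  refine Subtype.ext (iso_ext_of_local hT hF (v := v) (c := c) ?_ hgh fun u => ?_)
  · rw [g.2.1, h.2.1]
  · by_cases hu : u = v
    · left; rw [hu]; exact hgh
    · exact Or.inr ⟨g.2.2.2 u hu, h.2.2.2 u hu⟩

theorem exists_mem_vertexGroup (hT : T.IsTree) (hF : SimplyTransitive F) (v : V)
    {σ : Equiv.Perm Ω} (hσ : σ ∈ F') : ∃ g ∈ vertexGroup c F F' v, localPerm c g v = σ := by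
  obtain ⟨g, h1, h2, h3⟩ := exists_lift (c := c) hT hF v v σ
  exact ⟨g, ⟨h1, h2 ▸ hσ, h3⟩, h2⟩

theorem mem_universalGroup_of_localPerm_mem {v : V} {g : T ≃g T} (hg : g ∈ vertexGroup c F F' v)
    (h : localPerm c g v ∈ F) : g ∈ universalGroup c F := by
  intro u
  by_cases hu : u = v
  · rw [hu]; exact h
  · exact hg.2.2 u hu

theorem mem_vertexGroup_of_mem_universalGroup (hle : F ≤ F') {v : V} {g : T ≃g T}
    (hg : g ∈ universalGroup c F) (hv : g v = v) : g ∈ vertexGroup c F F' v :=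
  ⟨hv, hle (hg v), fun u _ => hg u⟩

/-- The elements of `U(F)` fixing `u` act transitively on the neighbours of `u`. -/
theorem exists_mem_vertexGroup_map_nb (hT : T.IsTree) (hF : SimplyTransitive F) (hle : F ≤ F')
    (u : V) (a b : Ω) :
    ∃ g ∈ vertexGroup c F F' u, g ∈ universalGroup c F ∧ g (c.nb u a) = c.nb u b := by
  obtain ⟨σ, hσ, hab⟩ := (hF a b).exists
  obtain ⟨g, hg, hgσ⟩ := exists_mem_vertexGroup (c := c) hT hF u (hle hσ)
  exact ⟨g, hg, mem_universalGroup_of_localPerm_mem hg (hgσ ▸ hσ),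
    by rw [c.map_nb, hg.1, hgσ, hab]⟩

theorem conj_mem_vertexGroup (hle : F ≤ F') {g k : T ≃g T} (hg : g ∈ universalGroup c F) {v : V}
    (hk : k ∈ vertexGroup c F F' v) : g * k * g⁻¹ ∈ vertexGroup c F F' (g v) := by
  have h0 : g⁻¹ (g v) = v := RelIso.inv_apply_self g v
  refine ⟨?_, ?_, fun u hu => ?_⟩
  · rw [RelIso.mul_apply, h0, RelIso.mul_apply, hk.1]
  · rw [localPerm_mul, h0, localPerm_mul, localPerm_inv, h0]
    exact F'.mul_mem (F'.mul_mem (hle (hg _)) hk.2.1) (F'.inv_mem (hle (hg _)))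
  · rw [localPerm_mul, localPerm_mul, localPerm_inv]
    refine F.mul_mem (F.mul_mem (hg _) (hk.2.2 _ fun h => hu ?_)) (F.inv_mem (hg _))
    rw [← h, RelIso.apply_inv_self]

/-- The vertex group at `u` contains elements of `U(F)` permuting the neighbours of `u`
transitively. Conjugation by them carries the vertex group of one neighbour to that of any other,
and connectedness spreads this over the tree. -/
theorem vertexGroup_le_of_adj (hT : T.IsTree) (hF : SimplyTransitive F) (hle : F ≤ F')
    {Q : Subgroup (T ≃g T)} {v : V} {a : Ω} (h1 : vertexGroup c F F' v ≤ Q)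
    (h2 : vertexGroup c F F' (c.nb v a) ≤ Q) (u : V) : vertexGroup c F F' u ≤ Q := by
  have step : ∀ u a b, vertexGroup c F F' u ≤ Q → vertexGroup c F F' (c.nb u a) ≤ Q →
      vertexGroup c F F' (c.nb u b) ≤ Q := by
    intro u a b hu ha k hk
    obtain ⟨g, hg, hgU, hgab⟩ := exists_mem_vertexGroup_map_nb (c := c) hT hF hle u b a
    have h3 := ha (hgab ▸ conj_mem_vertexGroup hle hgU hk)
    have h4 := Q.mul_mem (Q.mul_mem (Q.inv_mem (hu hg)) h3) (hu hg)
    convert h4 using 1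
    group
  have key : vertexGroup c F F' u ≤ Q ∧ ∀ b, vertexGroup c F F' (c.nb u b) ≤ Q := by
    induction u using c.induction_nb hT.connected v with
    | h0 => exact ⟨h1, fun b => step v a b h1 h2⟩
    | h u b ih =>
      exact ⟨ih.2 b, fun d => step (c.nb u b) b d (ih.2 b) (by rw [nb_nb]; exact ih.1)⟩
  exact key.1

/-- Each singularity `v` of `g` is removed by a left factor in the vertex group of `g v` with local
permutation inverse to that of `g`; elsewhere this factor only contributes elements of `F`. -/
theorem exists_mul_mem_universalGroup (hT : T.IsTree) (hF : SimplyTransitive F) (hle : F ≤ F')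
    {g : T ≃g T} (hg : g ∈ restrictedUniversalGroup c F F') :
    ∃ k ∈ ⨆ v, vertexGroup c F F' v, k * g ∈ universalGroup c F := by
  obtain ⟨hfin, hg⟩ := hg
  have key : ∀ (s : Finset V) (g : T ≃g T), g ∈ universalGroup c F' →
      (∀ u, localPerm c g u ∉ F → u ∈ s) →
      ∃ k ∈ ⨆ v, vertexGroup c F F' v, k * g ∈ universalGroup c F := by
    intro s
    classical
    induction s using Finset.induction_on with
    | empty =>
      intro g _ h
      refine ⟨1, Subgroup.one_mem _, fun u => ?_⟩
      rw [one_mul]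
      by_contra hu
      simpa using h u hu
    | insert v s _ ih =>
      intro g hg h
      obtain ⟨k, hk, hkv⟩ := exists_mem_vertexGroup (c := c) (F' := F') hT hF (g v)
        (F'.inv_mem (hg v))
      obtain ⟨k', hk', hU⟩ := ih (k * g)
        (Subgroup.mul_mem _ (mem_restricted_of_mem_vertexGroup hle hk).2 hg) (by
          intro u hu
          by_cases huv : u = v
          · subst huv
            rw [localPerm_mul, hkv, inv_mul_cancel] at hu
            exact absurd F.one_mem hu
          · have hu' : localPerm c g u ∉ F := fun h' => hu <| by
              rw [localPerm_mul]
              exact F.mul_mem (hk.2.2 _ fun h => huv (g.injective h)) h'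
            exact Finset.mem_of_mem_insert_of_ne (h u hu') huv)
      exact ⟨k' * k, Subgroup.mul_mem _ hk' (le_iSup (vertexGroup c F F') (g v) hk),
        by rwa [mul_assoc]⟩
  exact key (Set.Finite.toFinset hfin) g hg fun u hu => (Set.Finite.mem_toFinset hfin).2 hu

/-- A path of even length is folded two edges at a time by a rotation in `U(F)` about the middle
vertex of the first two edges. -/
theorem exists_map_act_eq (hT : T.IsTree) (hF : SimplyTransitive F) (hle : F ≤ F') :
    ∀ (l : List Ω) (v : V), Even l.length →
      ∃ k ∈ ⨆ v, vertexGroup c F F' v, k ∈ universalGroup c F ∧ k (c.act v l) = v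
  | [], _, _ => ⟨1, Subgroup.one_mem _, Subgroup.one_mem _, rfl⟩
  | [a], _, h => by simp at h
  | a :: b :: l, v, h => by
    obtain ⟨k, hk, hkU, hkv⟩ := exists_map_act_eq hT hF hle l (c.nb (c.nb v a) b) (by
      simpa [Nat.even_add_one] using h)
    obtain ⟨g, hg, hgU, hgab⟩ := exists_mem_vertexGroup_map_nb (c := c) hT hF hle (c.nb v a) b a
    refine ⟨g * k, Subgroup.mul_mem _ (le_iSup (vertexGroup c F F') _ hg) hk,
      Subgroup.mul_mem _ hgU hkU, ?_⟩
    rw [RelIso.mul_apply, act_cons, act_cons, hkv, hgab, nb_nb]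

/-- The type-preserving group is generated by its elements with at most one singularity which
fix this singularity. -/
theorem typePreservingGroup_eq (hT : T.IsTree) (hF : SimplyTransitive F) (hle : F ≤ F') (v : V) :
    typePreservingGroup c hT F F' v = ⨆ v, vertexGroup c F F' v := by
  have hC : ⨆ v, vertexGroup c F F' v ≤ typePreservingGroup c hT F F' v :=
    iSup_le fun u => vertexGroup_le_typePreservingGroup hT hle v u
  refine le_antisymm (fun g hg => ?_) hC
  obtain ⟨k, hk, hkU⟩ := exists_mul_mem_universalGroup hT hF hle hg.1
  have htype : (-1 : ℤˣ) ^ (c.wd v ((k * g) v)).length = 1 :=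
    (Subgroup.mul_mem _ (hC hk) hg).2
  have heven : Even (c.wd v ((k * g) v)).length := by
    rcases Nat.even_or_odd (c.wd v ((k * g) v)).length with h | h
    · exact h
    · rw [h.neg_one_pow] at htype
      exact absurd htype (by decide)
  obtain ⟨h, hh, hhU, hhv⟩ := exists_map_act_eq (c := c) hT hF hle _ v heven
  rw [act_wd hT] at hhv
  have h1 := le_iSup (vertexGroup c F F') v
    (mem_vertexGroup_of_mem_universalGroup hle (Subgroup.mul_mem _ hhU hkU) hhv)
  have h2 := Subgroup.mul_mem _ (Subgroup.inv_mem _ (Subgroup.mul_mem _ hh hk)) h1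
  convert h2 using 1
  group

theorem vertexGroup_le_of_le_map (hT : T.IsTree) (hF : SimplyTransitive F) {v : V}
    {Q : Subgroup (T ≃g T)}
    (h : F' ≤ (Q.subgroupOf (vertexGroup c F F' v)).map (vertexHom c F F' v)) :
    vertexGroup c F F' v ≤ Q := by
  intro k hk
  obtain ⟨k', hk', h2⟩ := h hk.2.1
  have h3 := vertexHom_injective hT hF v (a₁ := k') (a₂ := ⟨k, hk⟩) h2
  rw [h3] at hk'
  exact hk'

/-- The type-preserving group is generated by lifts, at two adjacent vertices, of a generating set
of `F'`. -/
theorem typePreservingGroup_eq_closure (hT : T.IsTree) (hF : SimplyTransitive F) (hle : F ≤ F')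
    (v : V) (a : Ω) {A : Set (Equiv.Perm Ω)} (hA : Subgroup.closure A = F') :
    typePreservingGroup c hT F F' v =
      Subgroup.closure ({g | g ∈ vertexGroup c F F' v ∧ localPerm c g v ∈ A} ∪
        {g | g ∈ vertexGroup c F F' (c.nb v a) ∧ localPerm c g (c.nb v a) ∈ A}) := by
  set Q := Subgroup.closure ({g | g ∈ vertexGroup c F F' v ∧ localPerm c g v ∈ A} ∪
        {g | g ∈ vertexGroup c F F' (c.nb v a) ∧ localPerm c g (c.nb v a) ∈ A}) with hQ
  have key : ∀ u, (∀ g, g ∈ vertexGroup c F F' u → localPerm c g u ∈ A → g ∈ Q) →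
      vertexGroup c F F' u ≤ Q := by
    intro u hu
    apply vertexGroup_le_of_le_map hT hF
    conv_lhs => rw [← hA]
    rw [Subgroup.closure_le]
    intro σ hσ
    obtain ⟨g, hg, hgσ⟩ := exists_mem_vertexGroup (c := c) (F' := F') hT hF u
      (hA ▸ Subgroup.subset_closure hσ)
    exact ⟨⟨g, hg⟩, hu g hg (hgσ ▸ hσ), hgσ⟩
  apply le_antisymm
  · rw [typePreservingGroup_eq hT hF hle v]
    refine iSup_le (vertexGroup_le_of_adj hT hF hle (v := v) (a := a) (key v ?_) (key _ ?_))
    · exact fun g h1 h2 => Subgroup.subset_closure (Or.inl ⟨h1, h2⟩)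
    · exact fun g h1 h2 => Subgroup.subset_closure (Or.inr ⟨h1, h2⟩)
  · rw [hQ, Subgroup.closure_le]
    rintro g (hg | hg)
    · exact vertexGroup_le_typePreservingGroup hT hle v _ hg.1
    · exact vertexGroup_le_typePreservingGroup hT hle v _ hg.1

theorem finite_vertexGroup [Finite Ω] (hT : T.IsTree) (hF : SimplyTransitive F)
    (v : V) : (vertexGroup c F F' v : Set (T ≃g T)).Finite := by
  have : Finite (Equiv.Perm Ω) := inferInstance
  exact Finite.of_injective _ (vertexHom_injective (c := c) (F' := F') hT hF v)

end VertexGroups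

/-! ### Simplicity -/

section Simplicity

variable {V Ω : Type*} {T : SimpleGraph V} {c : LegalColoring T Ω}
  {F F' : Subgroup (Equiv.Perm Ω)}

open LegalColoring

/-- The half-tree containing `v` delimited by the edge of color `a` at `v`. -/
def halfTree (c : LegalColoring T Ω) (v : V) (a : Ω) : Set V := {u | (c.wd v u).head? ≠ some a}

theorem map_mem_halfTree (hT : T.IsTree) (g : T ≃g T) {v u : V} {a : Ω} :
    g u ∈ halfTree c (g v) (localPerm c g v a) ↔ u ∈ halfTree c v a := by
  have h : (c.wd (g v) (g u)).head? = _ := head?_wd_map hT g v u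
  change (c.wd (g v) (g u)).head? ≠ _ ↔ (c.wd v u).head? ≠ _
  rw [h, not_iff_not]
  cases (c.wd v u).head? <;> simp

theorem mem_halfTree_nb (hT : T.IsTree) {v u : V} {a : Ω} :
    u ∈ halfTree c (c.nb v a) a ↔ u ∉ halfTree c v a := by
  change (c.wd (c.nb v a) u).head? ≠ some a ↔ ¬ (c.wd v u).head? ≠ some a
  have hc := wd_isChain (c := c) hT v u
  rcases wd_nb_left (c := c) hT v u a with h | ⟨h, h2⟩
  · rw [h] at hc ⊢
    simp only [List.head?_cons, ne_eq, not_true_eq_false, not_false_eq_true, iff_true]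
    intro h3
    exact (List.isChain_cons.1 hc).1 a h3 rfl
  · simp [h, h2]

theorem halfTree_subset_halfTree_nb (hT : T.IsTree) {v : V} {a b : Ω} (hab : a ≠ b) :
    halfTree c v a ⊆ halfTree c (c.nb v a) b := by
  intro u hu
  rcases wd_nb_left (c := c) hT v u a with h | ⟨h, h2⟩
  · exact absurd (by rw [h]; rfl) hu
  · change (c.wd (c.nb v a) u).head? ≠ some b
    simpa [h] using hab

/-- Beyond the fixed edge, every local permutation lies in `F` and fixes the color leading back,
hence is trivial. So `k` is supported on the half-tree containing `v`. -/
theorem fixes_of_not_mem_halfTree (hT : T.IsTree) (hF : SimplyTransitive F) {v : V} {a : Ω}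
    {k : T ≃g T} (hk : k ∈ vertexGroup c F F' v) (ha : localPerm c k v a = a) {u : V}
    (hu : u ∉ halfTree c v a) : k u = u := by
  have key : ∀ t : List Ω, (a :: t).IsChain (· ≠ ·) →
      k (c.act v (a :: t)) = c.act v (a :: t) ∧ localPerm c k (c.act v (a :: t)) = 1 := by
    intro t
    induction t using List.reverseRecOn with
    | nil =>
      intro _
      change k (c.nb v a) = c.nb v a ∧ localPerm c k (c.nb v a) = 1
      refine ⟨by rw [c.map_nb, hk.1, ha], ?_⟩
      refine hF.eq_of_apply_eq (hk.2.2 _ (c.nb_adj v a).ne') F.one_mem (a := a) ?_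
      rw [localPerm_nb, ha]; rfl
    | append_singleton t b ih =>
      intro hc
      have hne := c.act_ne_self hT.isAcyclic hc (by simp) (v := v)
      rw [← List.cons_append] at hc hne ⊢
      obtain ⟨h1, h2⟩ := ih hc.left_of_append
      rw [act_concat] at hne ⊢
      refine ⟨by rw [c.map_nb, h1, h2]; rfl, ?_⟩
      refine hF.eq_of_apply_eq (hk.2.2 _ hne) F.one_mem (a := b) ?_
      rw [localPerm_nb, h2]
  have hu' : (c.wd v u).head? = some a := not_not.1 hu
  have hw := act_wd (c := c) hT v u
  have hc := wd_isChain (c := c) hT v u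
  cases h : c.wd v u with
  | nil => simp [h] at hu'
  | cons b t =>
    rw [h] at hu' hw hc
    obtain rfl : b = a := by simpa using hu'
    rw [← hw]
    exact (key t hc).1

/-- A nontrivial automorphism maps some half-tree to a disjoint one. -/
theorem exists_halfTree_disjoint [Finite Ω] (hΩ : 3 ≤ Nat.card Ω) (hT : T.IsTree) {n : T ≃g T}
    (hn : n ≠ 1) : ∃ w b, ∀ u ∈ halfTree c w b, n u ∉ halfTree c w b := by
  obtain ⟨x, hx⟩ : ∃ x, n x ≠ x := by
    by_contra! h
    exact hn (RelIso.ext h)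
  -- Two colors are excluded: the one leading from `x` to `n x`, and the one whose image leads from
  -- `n x` back to `x`. A third exists because the degree is at least three; the branch at `x` along
  -- it and its image point away from each other.
  obtain ⟨b, hb1, hb2⟩ : ∃ b, (c.wd x (n x)).head? ≠ some b ∧
      (c.wd (n x) x).head? ≠ some (localPerm c n x b) := by
    classical
    have := Fintype.ofFinite Ω
    rw [Nat.card_eq_fintype_card] at hΩ
    by_contra! h
    cases h1 : (c.wd x (n x)).head? with
    | none => rw [List.head?_eq_none_iff, wd_eq_nil hT] at h1; exact hx h1
    | some b1 =>
    cases h2 : (c.wd (n x) x).head? with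
    | none => rw [List.head?_eq_none_iff, wd_eq_nil hT] at h2; exact hx h2.symm
    | some b2 =>
    rw [h1, h2] at h
    have : (Finset.univ : Finset Ω) ⊆ {b1, (localPerm c n x).symm b2} := by
      intro b _
      by_cases hb : b1 = b
      · simp [hb]
      · have := h b (by simpa using hb)
        simp only [Option.some.injEq] at this
        simp [this]
    have h3 := Finset.card_le_card this
    have h4 := Finset.card_le_two (a := b1) (b := (localPerm c n x).symm b2)
    rw [Finset.card_univ] at h3
    omega
  refine ⟨c.nb x b, b, fun u hu => ?_⟩
  rw [mem_halfTree_nb hT] at hu ⊢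
  have hu : (c.wd x u).head? = some b := not_not.1 hu
  rw [not_not]
  change (c.wd x (n u)).head? ≠ some b
  have h1 : (c.wd (n x) (n u)).head? = some (localPerm c n x b) := by
    rw [head?_wd_map hT, hu]; rfl
  have h2 : c.wd x (n u) = c.wd x (n x) ++ c.wd (n x) (n u) := by
    refine wd_eq hT (List.isChain_append.2 ⟨wd_isChain hT _ _, wd_isChain hT _ _, ?_⟩) ?_
    · rw [wd_symm hT (n x) x, List.getLast?_reverse]
      intro p hp q hq hpq
      rw [h1] at hq
      subst hpq
      rw [← Option.mem_some_iff.1 hq] at hp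
      exact hb2 hp
    · rw [act_append, act_wd hT, act_wd hT]
  rw [h2, List.head?_append]
  cases h3 : (c.wd x (n x)).head? with
  | none => rw [List.head?_eq_none_iff, wd_eq_nil hT] at h3; exact absurd h3 hx
  | some b1 => rw [h3] at hb1; simpa using hb1

/-- A displaced half-tree is transported by conjugation with an element of `U(F)`. This element must
preserve types; when the parity is wrong, the half-tree is first enlarged to one based at a
neighbouring vertex. -/
theorem exists_mem_displacing [Finite Ω] (hΩ : 3 ≤ Nat.card Ω) (hT : T.IsTree)
    (hF : SimplyTransitive F) (hle : F ≤ F') {v₀ : V} {N : Subgroup (T ≃g T)} (hN : N ≠ ⊥)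
    (hconj : ∀ h ∈ typePreservingGroup c hT F F' v₀, ∀ n ∈ N, h * n * h⁻¹ ∈ N) (v : V) (a : Ω) :
    ∃ n ∈ N, ∀ u ∈ halfTree c v a, n u ∉ halfTree c v a := by
  obtain ⟨⟨n, hnN⟩, hn⟩ := N.ne_bot_iff_exists_ne_one.1 hN
  obtain ⟨w, b, hwb⟩ := exists_halfTree_disjoint (c := c) hΩ hT (n := n)
    (fun h => hn (Subtype.ext h))
  have key : ∀ v a, (-1 : ℤˣ) ^ (c.wd v w).length = 1 →
      ∃ n ∈ N, ∀ u ∈ halfTree c v a, n u ∉ halfTree c v a := by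
    intro v a hv
    obtain ⟨σ, hσ, hab⟩ := (hF a b).exists
    obtain ⟨h, h1, h2, h3⟩ := exists_lift (c := c) hT hF v w σ
    have hU : h ∈ universalGroup c F := fun u => by
      by_cases hu : u = v
      · rw [hu, h2]; exact hσ
      · exact h3 u hu
    have hH : h ∈ typePreservingGroup c hT F F' v₀ := by
      refine ⟨⟨Set.finite_empty.subset fun u hu => hu (hU u), fun u => hle (hU u)⟩, ?_⟩
      change typeHom c hT v₀ h = 1
      rw [typeHom_eq hT v₀ v, h1, hv]
    refine ⟨h⁻¹ * n * h⁻¹⁻¹, hconj _ (Subgroup.inv_mem _ hH) _ hnN, fun u hu hcon => ?_⟩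
    rw [← map_mem_halfTree hT h, h1, h2, hab] at hu hcon
    refine hwb _ hu ?_
    rw [inv_inv, RelIso.mul_apply, RelIso.mul_apply, RelIso.apply_inv_self] at hcon
    exact hcon
  rcases neg_one_pow_eq_or ℤˣ (c.wd v w).length with h | h
  · exact key v a h
  · have : Nontrivial Ω := Finite.one_lt_card_iff_nontrivial.1 (by omega)
    obtain ⟨b', hb'⟩ := exists_ne a
    obtain ⟨n', hn', hd⟩ := key (c.nb v a) b' (by
      rcases wd_nb_left (c := c) hT v w a with h2 | ⟨h2, -⟩
      · rw [h2, List.length_cons, pow_succ] at h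
        simpa using h
      · rw [h2, List.length_cons, pow_succ, h]
        simp)
    exact ⟨n', hn', fun u hu hcon => hd u (halfTree_subset_halfTree_nb hT hb'.symm hu)
      (halfTree_subset_halfTree_nb hT hb'.symm hcon)⟩

/-- A nontrivial subgroup normalized by the type-preserving group contains the commutators of
elements supported on a common half-tree. -/
theorem commutator_mem [Finite Ω] (hΩ : 3 ≤ Nat.card Ω) (hT : T.IsTree)
    (hF : SimplyTransitive F) (hle : F ≤ F') {v₀ : V} {N : Subgroup (T ≃g T)} (hN : N ≠ ⊥)
    (hconj : ∀ h ∈ typePreservingGroup c hT F F' v₀, ∀ n ∈ N, h * n * h⁻¹ ∈ N) {v : V} {a : Ω}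
    {h k : T ≃g T} (hh : h ∈ vertexGroup c F F' v) (hha : localPerm c h v a = a)
    (hk : k ∈ vertexGroup c F F' v) (hka : localPerm c k v a = a) : h⁻¹ * k * h * k⁻¹ ∈ N := by
  obtain ⟨n, hn, hd⟩ := exists_mem_displacing (c := c) hΩ hT hF hle hN hconj v a
  have hH := vertexGroup_le_typePreservingGroup hT hle v₀ v (c := c) (F := F) (F' := F')
  have comm : ∀ k ∈ vertexGroup c F F' v, localPerm c k v a = a →
      k * (n * h * n⁻¹) = (n * h * n⁻¹) * k := by
    intro k hk hka
    have hfix : ∀ u ∈ halfTree c v a, (n * h * n⁻¹) u = u := by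
      intro u hu
      have : n⁻¹ u ∉ halfTree c v a := fun h => hd _ h (by rwa [RelIso.apply_inv_self])
      rw [RelIso.mul_apply, RelIso.mul_apply, fixes_of_not_mem_halfTree hT hF hh hha this,
        RelIso.apply_inv_self]
    refine RelIso.ext fun u => ?_
    change k ((n * h * n⁻¹) u) = (n * h * n⁻¹) (k u)
    by_cases hu : u ∈ halfTree c v a
    · have h2 : k u ∈ halfTree c v a := by
        rwa [← map_mem_halfTree hT k, hk.1, hka] at hu
      rw [hfix u hu, hfix _ h2]
    · have h2 : (n * h * n⁻¹) u ∉ halfTree c v a := by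
        intro h3
        have := (n * h * n⁻¹).injective (hfix _ h3)
        exact hu (this ▸ h3)
      rw [fixes_of_not_mem_halfTree hT hF hk hka hu, fixes_of_not_mem_halfTree hT hF hk hka h2]
  -- With `h' = n * h * n⁻¹`, the subgroup `N` contains `h' * h⁻¹` and its commutator with `k`.
  -- Since `h'` commutes with `h` and `k`, it cancels and the commutator of `h⁻¹` and `k` remains.
  have hm : (n * h * n⁻¹) * h⁻¹ ∈ N := by
    have := N.mul_mem hn (hconj h (hH hh) _ (N.inv_mem hn))
    convert this using 1
    group
  have hmk := N.mul_mem hm (hconj k (hH hk) _ (N.inv_mem hm))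
  have c1 := comm k hk hka
  have c2 := comm h hh hha
  generalize n * h * n⁻¹ = h' at *
  convert hmk using 1
  have c3 : h' * h⁻¹ = h⁻¹ * h' := by
    rw [eq_inv_mul_iff_mul_eq, ← mul_assoc, c2]; group
  calc h⁻¹ * k * h * k⁻¹ = h⁻¹ * (k * h') * h'⁻¹ * h * k⁻¹ := by group
    _ = h⁻¹ * h' * k * (h'⁻¹ * h) * k⁻¹ := by rw [c1]; group
    _ = h' * h⁻¹ * k * (h'⁻¹ * h) * k⁻¹ := by rw [c3]
    _ = h' * h⁻¹ * k * (h⁻¹ * h')⁻¹ * k⁻¹ := by group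
    _ = h' * h⁻¹ * (k * (h' * h⁻¹)⁻¹ * k⁻¹) := by rw [c3]; group

theorem typePreservingGroup_le_of_normalized [Finite Ω] (hΩ : 3 ≤ Nat.card Ω) (hT : T.IsTree)
    (hF : SimplyTransitive F) (hle : F ≤ F') (hF' : GeneratedByDerivedStabilizers F') {v₀ : V}
    {N : Subgroup (T ≃g T)} (hN : N ≠ ⊥)
    (hconj : ∀ h ∈ typePreservingGroup c hT F F' v₀, ∀ n ∈ N, h * n * h⁻¹ ∈ N) :
    typePreservingGroup c hT F F' v₀ ≤ N := by
  rw [typePreservingGroup_eq hT hF hle]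
  refine iSup_le fun v => vertexGroup_le_of_le_map hT hF ?_
  conv_lhs => rw [hF']
  refine iSup_le fun a => Subgroup.commutator_le.2 fun σ hσ τ hτ => ?_
  -- The inverse of `σ` is lifted because `commutator_mem` yields `h⁻¹ * k * h * k⁻¹`.
  obtain ⟨h, hh, hhσ⟩ := exists_mem_vertexGroup (c := c) hT hF v (inv_mem hσ.1)
  obtain ⟨k, hk, hkτ⟩ := exists_mem_vertexGroup (c := c) hT hF v hτ.1
  have hσa : σ⁻¹ a = a := by
    rw [Equiv.Perm.inv_eq_iff_eq]
    exact hσ.2.symm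
  have h1 := commutator_mem hΩ hT hF hle hN hconj hh (hhσ ▸ hσa) hk (hkτ ▸ hτ.2)
  let h' : vertexGroup c F F' v := ⟨h, hh⟩
  let k' : vertexGroup c F F' v := ⟨k, hk⟩
  refine ⟨h'⁻¹ * k' * h' * k'⁻¹, h1, ?_⟩
  have e1 : vertexHom c F F' v h' = σ⁻¹ := hhσ
  have e2 : vertexHom c F F' v k' = τ := hkτ
  rw [map_mul, map_mul, map_mul, map_inv, map_inv, e1, e2, commutatorElement_def, inv_inv]

end Simplicity

/-! ### Word metrics -/

section WordMetric

variable {Γ : Type*} [Group Γ] {S : Set Γ}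

theorem mulCayley_dist_mul_left_le (hS : Subgroup.closure S = ⊤) (g h k : Γ) :
    (SimpleGraph.mulCayley S).dist (g * h) (g * k) ≤ (SimpleGraph.mulCayley S).dist h k := by
  obtain ⟨p, hp⟩ := (mulCayley_connected hS).exists_walk_length_eq_dist h k
  let f : SimpleGraph.mulCayley S →g SimpleGraph.mulCayley S :=
    { toFun := (g * ·)
      map_rel' := by
        intro a b hab
        rw [SimpleGraph.mulCayley_adj'] at hab ⊢
        obtain ⟨hne, s, hs, h⟩ := hab
        refine ⟨fun h => hne (mul_left_cancel h), s, hs, h.imp ?_ ?_⟩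
        · rintro rfl; exact mul_assoc _ _ _
        · rintro rfl; exact (mul_assoc _ _ _).symm }
  rw [← hp, ← SimpleGraph.Walk.length_map f p]
  exact SimpleGraph.dist_le _

theorem mulCayley_dist_le_one (hS : Subgroup.closure S = ⊤) (h k : Γ) :
    (SimpleGraph.mulCayley S).dist h k ≤ (SimpleGraph.mulCayley S).dist 1 (h⁻¹ * k) := by
  have := mulCayley_dist_mul_left_le hS h 1 (h⁻¹ * k)
  rwa [mul_one, mul_inv_cancel_left] at this

theorem mulCayley_dist_one_le (hS : Subgroup.closure S = ⊤) (h k : Γ) :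
    (SimpleGraph.mulCayley S).dist 1 (h⁻¹ * k) ≤ (SimpleGraph.mulCayley S).dist h k := by
  have := mulCayley_dist_mul_left_le hS h⁻¹ h k
  rwa [inv_mul_cancel] at this

theorem finite_walk_of_length (hfin : S.Finite) (n : ℕ) (u : Γ) :
    {v | ∃ p : (SimpleGraph.mulCayley S).Walk u v, p.length = n}.Finite := by
  induction n generalizing u with
  | zero =>
    refine (Set.finite_singleton u).subset ?_
    rintro v ⟨p, hp⟩
    exact (SimpleGraph.Walk.eq_of_length_eq_zero hp).symm
  | succ n ih =>
    refine (((hfin.image (u * ·)).union (hfin.image (u * ·⁻¹))).biUnion fun w _ => ih w).subset ?_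
    rintro v ⟨p, hp⟩
    cases p with
    | nil => simp at hp
    | cons h p =>
      obtain ⟨-, s, hs, h⟩ := (SimpleGraph.mulCayley_adj' S _ _).1 h
      refine Set.mem_biUnion ?_ ⟨p, by simpa using hp⟩
      rcases h with rfl | rfl
      · exact Or.inl ⟨s, hs, rfl⟩
      · exact Or.inr ⟨s, hs, by simp⟩

theorem finite_mulCayley_ball (hS : Subgroup.closure S = ⊤) (hfin : S.Finite) (n : ℕ) :
    {g : Γ | (SimpleGraph.mulCayley S).dist 1 g ≤ n}.Finite := by
  refine ((Set.finite_Iic n).biUnion fun m _ => finite_walk_of_length hfin m 1).subset ?_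
  intro g hg
  obtain ⟨p, hp⟩ := (mulCayley_connected hS).exists_walk_length_eq_dist 1 g
  exact Set.mem_biUnion (show _ ∈ Set.Iic n from hg) ⟨p, hp⟩

/-- At scale 2, adjacent elements must share a member of the single family. By connectedness one
bounded member is the whole group, which would then be a finite ball. -/
theorem not_asdimLE_zero [Infinite Γ] (hS : Subgroup.closure S = ⊤) (hfin : S.Finite) :
    ¬ @AsdimLE Γ (wordMetric S hS) 0 := by
  let := wordMetric S hS
  intro h
  obtain ⟨𝓤, h1, ⟨C, hC⟩, h3⟩ := h 2 two_pos
  obtain ⟨i, A, hA, h1A⟩ := h3 1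
  have key : ∀ g, g ∈ A := by
    intro g
    obtain ⟨p⟩ := (mulCayley_connected hS).preconnected 1 g
    generalize (1 : Γ) = x at p h1A
    induction p with
    | nil => exact h1A
    | @cons x y z hadj p ih =>
      refine ih ?_
      obtain ⟨j, B, hB, hy⟩ := h3 y
      obtain rfl : i = j := Subsingleton.elim (α := Fin 1) i j
      by_contra hyA
      have h2 := h1 i A hA B hB (fun h => hyA (h ▸ hy)) x h1A y hy
      have h4 : dist x y = ((SimpleGraph.mulCayley S).dist x y : ℝ) := rfl
      rw [h4, SimpleGraph.dist_eq_one_iff_adj.2 hadj] at h2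
      norm_num at h2
  obtain ⟨n, hn⟩ := exists_nat_ge C
  refine Set.infinite_univ (α := Γ) ((finite_mulCayley_ball hS hfin n).subset fun g _ => ?_)
  have h2 : ((SimpleGraph.mulCayley S).dist 1 g : ℝ) ≤ n := (hC i A hA 1 h1A g (key g)).trans hn
  exact_mod_cast h2

end WordMetric

/-! ### Asymptotic dimension of groups with almost prescribed local action -/

section AsymptoticDimensionOfGroups

variable {V Ω : Type*} {T : SimpleGraph V} {c : LegalColoring T Ω}
  {F : Subgroup (Equiv.Perm Ω)}

open LegalColoring

/-- The vertices `u` and `w` are at distance at most `n`. -/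
def Near (c : LegalColoring T Ω) (n : ℕ) (u w : V) : Prop :=
  ∃ m : List Ω, m.length ≤ n ∧ c.act u m = w

theorem Near.symm {n : ℕ} {u w : V} (h : Near c n u w) : Near c n w u := by
  obtain ⟨m, hm, rfl⟩ := h
  exact ⟨m.reverse, by simpa using hm, c.act_act_reverse _ _⟩

theorem Near.trans {n m : ℕ} {u w x : V} (h : Near c n u w) (h' : Near c m w x) :
    Near c (n + m) u x := by
  obtain ⟨l, hl, rfl⟩ := h
  obtain ⟨l', hl', rfl⟩ := h'
  exact ⟨l ++ l', by rw [List.length_append]; omega, c.act_append _ _ _⟩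

theorem Near.map {n : ℕ} {u w : V} (h : Near c n u w) (g : T ≃g T) : Near c n (g u) (g w) := by
  obtain ⟨l, hl, rfl⟩ := h
  obtain ⟨l', h1, h2, -⟩ := exists_word_map (c := c) g u l
  exact ⟨l', h1 ▸ hl, h2.symm⟩

theorem finite_setOf_near [Finite Ω] (n : ℕ) (u : V) : {w | Near c n u w}.Finite := by
  refine ((List.finite_length_le Ω n).image (c.act u)).subset ?_
  rintro w ⟨m, hm, rfl⟩
  exact ⟨m, hm, rfl⟩

theorem exists_near_of_finite (hT : T.IsTree) (v : V) {s : Set V} (hs : s.Finite) :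
    ∃ n, ∀ u ∈ s, Near c n v u := by
  obtain ⟨n, hn⟩ := (hs.image fun u => (c.wd v u).length).bddAbove
  exact ⟨n, fun u hu => ⟨c.wd v u, hn ⟨u, hu, rfl⟩, act_wd hT v u⟩⟩

/-- Automorphisms with bounded displacement and bounded singularities form a finite set. -/
theorem finite_bounded_singularities [Finite Ω] (hT : T.IsTree) (hF : SimplyTransitive F)
    (v : V) (m n : ℕ) :
    {g : T ≃g T | Near c m v (g v) ∧ ∀ u, localPerm c g u ∉ F → Near c n v u}.Finite := by
  have := (finite_setOf_near (c := c) m v).to_subtype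
  have := (finite_setOf_near (c := c) n v).to_subtype
  refine Set.finite_coe_iff.1 (Finite.of_injective
    (β := {w | Near c m v w} × ({w | Near c n v w} → Equiv.Perm Ω))
    (fun g => (⟨g.1 v, g.2.1⟩, fun u => localPerm c g.1 u)) fun g h hgh => Subtype.ext ?_)
  obtain ⟨h1, h2⟩ := Prod.ext_iff.1 hgh
  have h3 : ∀ u, Near c n v u → localPerm c g.1 u = localPerm c h.1 u :=
    fun u hu => congrFun h2 ⟨u, hu⟩
  refine iso_ext_of_local hT hF (v := v) (c := c) (congrArg Subtype.val h1)
    (h3 v ⟨[], Nat.zero_le _, rfl⟩) fun u => ?_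
  by_cases hu : Near c n v u
  · exact Or.inl (h3 u hu)
  · exact Or.inr ⟨not_not.1 fun h => hu (g.2.2 u h), not_not.1 fun h' => hu (h.2.2 u h')⟩

/-- Each step alters only the end of the reduced word, so `m.length` steps cannot reach a prefix
this short. -/
theorem take_wd_act (hT : T.IsTree) (v u : V) (m : List Ω) {q : ℕ}
    (hq : q ≤ (c.wd v u).length - m.length) :
    (c.wd v (c.act u m)).take q = (c.wd v u).take q := by
  induction m generalizing u with
  | nil => rfl
  | cons a m ih =>
    rw [List.length_cons] at hq
    rw [act_cons]
    rcases wd_nb (c := c) hT v u a with h | h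
    · rw [h, List.length_append, List.length_singleton] at hq
      rw [ih _ (by omega), h, List.take_append_of_le_length (by omega)]
    · rw [ih _ (by rw [h, List.length_append, List.length_singleton]; omega), h,
        List.take_append_of_le_length (by omega)]

theorem near_of_take_eq (hT : T.IsTree) {v u w : V} {q n : ℕ}
    (h : (c.wd v u).take q = (c.wd v w).take q) (hu : (c.wd v u).length ≤ q + n)
    (hw : (c.wd v w).length ≤ q + n) : Near c (n + n) u w := by
  have aux : ∀ x, (c.wd v x).length ≤ q + n → Near c n (c.act v ((c.wd v x).take q)) x := by
    intro x hx
    refine ⟨(c.wd v x).drop q, by rw [List.length_drop]; omega, ?_⟩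
    rw [← act_append, List.take_append_drop, act_wd hT]
  exact (aux u hu).symm.trans (h ▸ aux w hw)

theorem length_wd_le_of_near (hT : T.IsTree) {v u w : V} {n : ℕ} (h : Near c n u w) :
    (c.wd v w).length ≤ (c.wd v u).length + n := by
  obtain ⟨m, hm, rfl⟩ := h
  suffices (c.wd v (c.act u m)).length ≤ (c.wd v u).length + m.length by omega
  clear hm
  induction m generalizing u with
  | nil => simp
  | cons a m ih =>
    have h1 := ih (u := c.nb u a)
    rw [act_cons, List.length_cons]
    rcases wd_nb (c := c) hT v u a with h | h
    · rw [h, List.length_append]; simp; omega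
    · rw [h, List.length_append, List.length_singleton] at h1; omega

/-- Finitely generated groups of automorphisms whose local permutations almost all belong to a
simply transitive group have asymptotic dimension at most one. -/
theorem asdimLE_one [Finite Ω] (hT : T.IsTree) (hF : SimplyTransitive F) {Γ : Type*} [Group Γ]
    {φ : Γ →* (T ≃g T)} (hφ : Function.Injective φ)
    (hφF : ∀ γ, φ γ ∈ almostPrescribedGroup c F) {S : Set Γ} (hfin : S.Finite)
    (hS : Subgroup.closure S = ⊤) : @AsdimLE Γ (wordMetric S hS) 1 := by
  let := wordMetric S hS
  have dist_def : ∀ x y : Γ, dist x y = ((SimpleGraph.mulCayley S).dist x y : ℝ) :=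
    fun _ _ => rfl
  obtain ⟨v⟩ := hT.connected.nonempty
  intro r hr
  have hB : {s : Γ | dist 1 s < r}.Finite := by
    obtain ⟨n, hn⟩ := exists_nat_ge r
    refine (finite_mulCayley_ball hS hfin n).subset fun g hg => ?_
    have : ((SimpleGraph.mulCayley S).dist 1 g : ℝ) ≤ n := (hg.trans_le hn).le
    exact_mod_cast this
  have hdist : ∀ x y : Γ, dist x y < r → dist 1 (x⁻¹ * y) < r := fun x y h =>
    lt_of_le_of_lt (by rw [dist_def, dist_def]; exact_mod_cast mulCayley_dist_one_le hS x y) h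
  -- displacement and singularities of the elements of the ball of radius `r`
  obtain ⟨L, hL⟩ := exists_near_of_finite (c := c) hT v (hB.image fun s => φ s v)
  obtain ⟨R, hR⟩ := exists_near_of_finite (c := c) hT v
    (hB.biUnion fun s _ => show {u | localPerm c (φ s⁻¹) u ∉ F}.Finite from hφF s⁻¹)
  have hstep : ∀ x y : Γ, dist x y < r → Near c L (φ x v) (φ y v) := by
    intro x y h
    have h1 := (hL _ ⟨x⁻¹ * y, hdist x y h, rfl⟩).map (φ x)
    rwa [← RelIso.mul_apply, ← map_mul, mul_inv_cancel_left] at h1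
  -- Annuli of width greater than `L`: a step of length less than `r` changes the annulus index by
  -- at most one, and not at all when the parities agree.
  let M := L + 1
  let ℓ : Γ → ℕ := fun x => (c.wd v (φ x v)).length
  let k : Γ → ℕ := fun x => ℓ x / M
  have hk1 : ∀ x, k x * M ≤ ℓ x := fun x => Nat.div_mul_le_self _ _
  have hk2 : ∀ x, ℓ x < (k x + 1) * M := fun x => by
    have := Nat.lt_mul_div_succ (ℓ x) (Nat.succ_pos L)
    rwa [mul_comm] at this
  let Rel : ℕ → Γ → Γ → Prop := fun i x y => k x % 2 = i ∧ k y % 2 = i ∧ dist x y < r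
  have hsymm : ∀ i x y, Rel i x y → Rel i y x := fun i x y h => ⟨h.2.1, h.1, dist_comm x y ▸ h.2.2⟩
  have hkle : ∀ x y, dist x y < r → k y ≤ k x + 1 := by
    intro x y h
    have h1 : ℓ y ≤ ℓ x + L := length_wd_le_of_near hT (hstep x y h)
    have h2 := hk2 x
    have h3 := hk1 y
    have h4 : k y * M < (k x + 1 + 1) * M := by
      rw [add_mul (k x + 1) 1 M]; omega
    have := Nat.lt_of_mul_lt_mul_right h4
    omega
  have hkeq : ∀ i x y, Rel i x y → k y = k x := by
    intro i x y h
    have h1 := hkle x y h.2.2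
    have h2 := hkle y x (dist_comm x y ▸ h.2.2)
    have h3 := h.1
    have h4 := h.2.1
    omega
  -- The endpoints of a chain share a prefix of length `k x * M - L` and have length less than `(k x
  -- + 1) * M`, so each is within `2 * M` of the vertex reached by that prefix. Truncated
  -- subtraction is harmless when `k x = 0`.
  let D := 2 * M + 2 * M
  -- chains issued from `x` are bounded
  have hchain : ∀ i x y, Relation.ReflTransGen (Rel i) x y →
      k y = k x ∧ (c.wd v (φ y v)).take (k x * M - L) = (c.wd v (φ x v)).take (k x * M - L) := by
    intro i x y h
    induction h with
    | refl => exact ⟨rfl, rfl⟩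
    | @tail y z _ hyz ih =>
      refine ⟨(hkeq i y z hyz).trans ih.1, ?_⟩
      rw [← ih.2]
      obtain ⟨m, hm, hmz⟩ := hstep y z hyz.2.2
      rw [← hmz]
      refine take_wd_act hT v _ m ?_
      have h1 : k y * M ≤ (c.wd v (φ y v)).length := hk1 y
      rw [ih.1] at h1
      omega
  have hnear : ∀ i x y, Relation.ReflTransGen (Rel i) x y → Near c D v (φ (y⁻¹ * x) v) := by
    intro i x y h
    obtain ⟨h1, h2⟩ := hchain i x y h
    have h3 := hk2 x
    have h4 := hk2 y
    rw [h1] at h4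
    rw [add_mul, one_mul] at h3 h4
    have h5 : Near c D (φ y v) (φ x v) :=
      near_of_take_eq hT h2 (n := 2 * M) (by change ℓ y ≤ _; omega) (by change ℓ x ≤ _; omega)
    have h6 := h5.map (φ y⁻¹)
    rwa [← RelIso.mul_apply, ← RelIso.mul_apply, ← map_mul, ← map_mul, inv_mul_cancel, map_one]
      at h6
  -- The bound does not grow with the chain: a new singularity is pulled back by `φ (y⁻¹ * x)` from
  -- the ball of radius `R` around `v`, and this map displaces `v` by at most `D`.
  have hsing : ∀ i x y, Relation.ReflTransGen (Rel i) x y →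
      ∀ u, localPerm c (φ (y⁻¹ * x)) u ∉ F → Near c (D + R) v u := by
    intro i x y h
    induction h with
    | refl =>
      intro u hu
      rw [inv_mul_cancel, map_one, localPerm_one] at hu
      exact absurd F.one_mem hu
    | @tail y z hxy hyz ih =>
      intro u hu
      have h1 : z⁻¹ * x = (y⁻¹ * z)⁻¹ * (y⁻¹ * x) := by group
      rw [h1, map_mul, localPerm_mul] at hu
      by_cases h2 : localPerm c (φ (y⁻¹ * x)) u ∈ F
      · have h3 : localPerm c (φ (y⁻¹ * z)⁻¹) (φ (y⁻¹ * x) u) ∉ F := fun h => hu (F.mul_mem h h2)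
        have h4 := hR _ (Set.mem_biUnion (show y⁻¹ * z ∈ {s : Γ | dist 1 s < r} from
          hdist y z hyz.2.2) h3)
        have h5 := ((hnear i x y hxy).symm.trans h4).map (φ (y⁻¹ * x))⁻¹
        rwa [RelIso.inv_apply_self, RelIso.inv_apply_self] at h5
      · exact ih u h2
  obtain ⟨C, hC⟩ : ∃ C : ℝ, ∀ i x y, Relation.ReflTransGen (Rel i) x y → dist x y ≤ C := by
    have hE := (finite_bounded_singularities (c := c) hT hF v D (D + R)).preimage
      hφ.injOn
    obtain ⟨C, hC⟩ := (hE.image fun g => dist 1 g).bddAbove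
    refine ⟨C, fun i x y h => ?_⟩
    have h1 : dist 1 (y⁻¹ * x) ≤ C := hC ⟨y⁻¹ * x, ⟨hnear i x y h, hsing i x y h⟩, rfl⟩
    refine le_trans ?_ h1
    rw [dist_comm, dist_def, dist_def]
    exact_mod_cast mulCayley_dist_le_one hS y x
  have hpar : ∀ i x y, k x % 2 = i → Relation.ReflTransGen (Rel i) x y → k y % 2 = i := by
    intro i x y hx h
    rw [(hchain i x y h).1, hx]
  -- The two families consist of the components at scale `r` of the even and of the odd annuli.
  refine ⟨fun i => {A | ∃ x, k x % 2 = i ∧ A = {y | Relation.ReflTransGen (Rel i) x y}},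
    ?_, ⟨C + C, ?_⟩, ?_⟩
  · rintro i A ⟨x, hx, rfl⟩ B ⟨y, hy, rfl⟩ hAB a ha b hb
    by_contra! hab
    have h1 : Rel i a b := ⟨hpar _ _ _ hx ha, hpar _ _ _ hy hb, hab⟩
    have : Std.Symm (Rel i) := ⟨hsymm i⟩
    have hs : ∀ {x y}, Relation.ReflTransGen (Rel i) x y → Relation.ReflTransGen (Rel i) y x :=
      fun h => Std.Symm.symm _ _ h
    have hxy : Relation.ReflTransGen (Rel i) x y := (Relation.ReflTransGen.tail ha h1).trans (hs hb)
    exact hAB (Set.ext fun z => ⟨fun h => (hs hxy).trans h, fun h => hxy.trans h⟩)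
  · rintro i A ⟨x, hx, rfl⟩ a ha b hb
    refine (dist_triangle_left a b x).trans (add_le_add (hC _ _ _ ha) (hC _ _ _ hb))
  · intro x
    exact ⟨⟨k x % 2, Nat.mod_lt _ two_pos⟩, _, ⟨x, rfl, rfl⟩, Relation.ReflTransGen.refl⟩

theorem groupHasAsdim_one [Finite Ω] (hT : T.IsTree) (hF : SimplyTransitive F) {Γ : Type*}
    [Group Γ] [Infinite Γ] (hfg : Group.FG Γ) {φ : Γ →* (T ≃g T)} (hφ : Function.Injective φ)
    (hφF : ∀ γ, φ γ ∈ almostPrescribedGroup c F) : GroupHasAsdim Γ 1 := by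
  refine ⟨hfg, fun S hfin hS => le_antisymm ?_ ?_⟩
  · exact sInf_le ⟨1, rfl, asdimLE_one hT hF hφ hφF hfin hS⟩
  · refine le_sInf ?_
    rintro _ ⟨n, rfl, hn⟩
    rcases Nat.eq_zero_or_pos n with rfl | h
    · exact absurd hn (not_asdimLE_zero hS hfin)
    · exact_mod_cast h

end AsymptoticDimensionOfGroups

/-! ### The subgroup of index two -/

section IndexTwo

variable {V Ω : Type*} {T : SimpleGraph V} {c : LegalColoring T Ω}
  {F F' : Subgroup (Equiv.Perm Ω)}

open LegalColoring

/-- The type-preserving elements of `G(F, F')`, as a subgroup of `G(F, F')`. -/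
noncomputable def evenSubgroup (c : LegalColoring T Ω) (hT : T.IsTree)
    (F F' : Subgroup (Equiv.Perm Ω)) (v : V) : Subgroup (restrictedUniversalGroup c F F') :=
  (typeHom c hT v).ker.subgroupOf (restrictedUniversalGroup c F F')

/-- The inclusion of the type-preserving elements of `G(F, F')` in `Aut(T)`. -/
noncomputable def evenInclusion (c : LegalColoring T Ω) (hT : T.IsTree)
    (F F' : Subgroup (Equiv.Perm Ω)) (v : V) : evenSubgroup c hT F F' v →* (T ≃g T) :=
  (restrictedUniversalGroup c F F').subtype.comp (evenSubgroup c hT F F' v).subtype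

theorem evenInclusion_injective (hT : T.IsTree) (v : V) :
    Function.Injective (evenInclusion c hT F F' v) :=
  Subtype.val_injective.comp Subtype.val_injective

theorem evenInclusion_mem (hT : T.IsTree) (v : V) (γ : evenSubgroup c hT F F' v) :
    evenInclusion c hT F F' v γ ∈ typePreservingGroup c hT F F' v :=
  ⟨γ.1.2, γ.2⟩

theorem exists_evenInclusion_eq (hT : T.IsTree) {v : V} {g : T ≃g T}
    (hg : g ∈ typePreservingGroup c hT F F' v) : ∃ γ, evenInclusion c hT F F' v γ = g :=
  ⟨⟨⟨g, hg.1⟩, hg.2⟩, rfl⟩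

theorem evenSubgroup_index (hT : T.IsTree) (hF : SimplyTransitive F) (hle : F ≤ F') (v : V)
    (a : Ω) : (evenSubgroup c hT F F' v).index = 2 := by
  have h1 : evenSubgroup c hT F F' v =
      ((typeHom c hT v).comp (restrictedUniversalGroup c F F').subtype).ker := rfl
  obtain ⟨g, hg1, hg2, hg3⟩ := exists_lift (c := c) hT hF v (c.nb v a) 1
  have hU : g ∈ universalGroup c F := fun u => by
    by_cases hu : u = v
    · rw [hu, hg2]; exact F.one_mem
    · exact hg3 u hu
  have hG : g ∈ restrictedUniversalGroup c F F' :=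
    ⟨Set.finite_empty.subset fun u hu => hu (hU u), fun u => hle (hU u)⟩
  have htop : ((typeHom c hT v).comp (restrictedUniversalGroup c F F').subtype).range = ⊤ := by
    rw [MonoidHom.range_eq_top]
    intro x
    rcases Int.units_eq_one_or x with rfl | rfl
    · exact ⟨1, map_one _⟩
    · refine ⟨⟨g, hG⟩, ?_⟩
      change (-1 : ℤˣ) ^ (c.wd v (g v)).length = -1
      rw [hg1, wd_eq hT (List.isChain_singleton a) (show c.act v [a] = c.nb v a from rfl)]
      simp
  rw [h1, Subgroup.index_ker, htop, Subgroup.card_top, Nat.card_eq_fintype_card]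
  rfl

theorem exists_generators (hT : T.IsTree) {v : V} {ι : Type*} {s : ι → (T ≃g T)}
    (hs : Subgroup.closure (Set.range s) = typePreservingGroup c hT F F' v) :
    ∃ s' : ι → evenSubgroup c hT F F' v, Subgroup.closure (Set.range s') = ⊤ := by
  choose s' hs' using fun i => exists_evenInclusion_eq (c := c) (F := F) (F' := F') hT (v := v)
    (g := s i) (hs ▸ Subgroup.subset_closure ⟨i, rfl⟩)
  refine ⟨s', Subgroup.map_injective (evenInclusion_injective hT v) ?_⟩
  rw [MonoidHom.map_closure, ← Set.range_comp,
    show (evenInclusion c hT F F' v : _ → _) ∘ s' = s from funext hs', hs]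
  ext g
  constructor
  · intro hg
    obtain ⟨γ, hγ⟩ := exists_evenInclusion_eq hT hg
    exact ⟨γ, trivial, hγ⟩
  · rintro ⟨γ, -, rfl⟩
    exact evenInclusion_mem hT v γ

theorem evenSubgroup_fg [Finite Ω] (hT : T.IsTree) (hF : SimplyTransitive F) (hle : F ≤ F')
    (v : V) (a : Ω) : Group.FG (evenSubgroup c hT F F' v) := by
  have h := typePreservingGroup_eq_closure (c := c) hT hF hle v a (A := F') F'.closure_eq
  rw [← Subtype.range_coe (s := _ ∪ _)] at h
  obtain ⟨s', hs'⟩ := exists_generators hT h.symm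
  have hfin : ∀ u, {g | g ∈ vertexGroup c F F' u ∧ localPerm c g u ∈ (F' : Set _)}.Finite :=
    fun u => (finite_vertexGroup hT hF u).subset fun g hg => hg.1
  have := ((hfin v).union (hfin (c.nb v a))).to_subtype
  exact Group.fg_iff.2 ⟨_, hs', Set.finite_range _⟩

/-- Two generators of `F'` have unique lifts at each vertex, and the lifts at two adjacent vertices
generate. -/
theorem evenSubgroup_four_generators (hT : T.IsTree) (hF : SimplyTransitive F) (hle : F ≤ F')
    (v : V) (a : Ω) {σ τ : Equiv.Perm Ω} (hst : Subgroup.closure {σ, τ} = F') :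
    ∃ s : Fin 4 → evenSubgroup c hT F F' v, Subgroup.closure (Set.range s) = ⊤ := by
  have h := typePreservingGroup_eq_closure (c := c) hT hF hle v a hst
  have hσ : σ ∈ F' := hst ▸ Subgroup.subset_closure (by simp)
  have hτ : τ ∈ F' := hst ▸ Subgroup.subset_closure (by simp)
  have aux : ∀ u, ∃ x y, {g | g ∈ vertexGroup c F F' u ∧
      localPerm c g u ∈ ({σ, τ} : Set (Equiv.Perm Ω))} = {x, y} := by
    intro u
    obtain ⟨x, hx, hxσ⟩ := exists_mem_vertexGroup (c := c) hT hF u hσ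
    obtain ⟨y, hy, hyτ⟩ := exists_mem_vertexGroup (c := c) hT hF u hτ
    refine ⟨x, y, Set.ext fun g => ⟨?_, ?_⟩⟩
    · rintro ⟨hg, h | h⟩
      · exact Or.inl (congrArg Subtype.val
          (vertexHom_injective hT hF u (a₁ := ⟨g, hg⟩) (a₂ := ⟨x, hx⟩) (h.trans hxσ.symm)))
      · exact Or.inr (congrArg Subtype.val
          (vertexHom_injective hT hF u (a₁ := ⟨g, hg⟩) (a₂ := ⟨y, hy⟩) (h.trans hyτ.symm)))
    · rintro (rfl | rfl)
      · exact ⟨hx, Or.inl hxσ⟩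
      · exact ⟨hy, Or.inr hyτ⟩
  obtain ⟨x, y, h1⟩ := aux v
  obtain ⟨z, w, h2⟩ := aux (c.nb v a)
  rw [h1, h2] at h
  refine exists_generators hT (s := ![x, y, z, w]) (h.symm ▸ congrArg _ ?_)
  ext g
  simp only [Set.mem_range, Fin.exists_fin_succ, Set.mem_union, Set.mem_insert_iff,
    Set.mem_singleton_iff]
  simp [eq_comm, or_assoc]

theorem evenSubgroup_infinite [Finite Ω] (hΩ : 3 ≤ Nat.card Ω) (hT : T.IsTree)
    (hF : SimplyTransitive F) (hle : F ≤ F') (v : V) : Infinite (evenSubgroup c hT F F' v) := by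
  have : Nontrivial Ω := Finite.one_lt_card_iff_nontrivial.1 (by omega)
  obtain ⟨a, b, hab⟩ := exists_pair_ne Ω
  -- Powers of the word `a b`; the condition on the first letter keeps the word reduced when `a b`
  -- is prepended. By folding, `v` is moved to every even distance.
  have hl : ∀ n : ℕ, ∃ l : List Ω, l.length = 2 * n ∧ l.IsChain (· ≠ ·) ∧ l.head? ≠ some b := by
    intro n
    induction n with
    | zero => exact ⟨[], rfl, List.isChain_nil, by simp⟩
    | succ n ih =>
      obtain ⟨l, h1, h2, h3⟩ := ih
      refine ⟨a :: b :: l, by simp [h1]; ring, ?_, by simpa using hab⟩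
      refine List.isChain_cons_cons.2 ⟨hab, List.isChain_cons.2 ⟨fun y hy hby => h3 ?_, h2⟩⟩
      rw [hby]; exact hy
  have hγ : ∀ n : ℕ, ∃ γ : evenSubgroup c hT F F' v,
      (c.wd v (evenInclusion c hT F F' v γ v)).length = 2 * n := by
    intro n
    obtain ⟨l, h1, h2, -⟩ := hl n
    obtain ⟨k, hk, -, hkv⟩ := exists_map_act_eq (c := c) hT hF hle l v (h1 ▸ even_two_mul n)
    rw [← typePreservingGroup_eq hT hF hle v] at hk
    obtain ⟨γ, hγ⟩ := exists_evenInclusion_eq hT (Subgroup.inv_mem _ hk)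
    refine ⟨γ, ?_⟩
    have h3 : k⁻¹ v = c.act v l := by
      conv_lhs => rw [← hkv]
      exact RelIso.inv_apply_self k _
    rw [hγ, h3, wd_act hT v h2, h1]
  choose γ hγ using hγ
  refine Infinite.of_injective γ fun m n hmn => ?_
  have h1 := hγ m
  rw [hmn, hγ n] at h1
  omega

theorem evenSubgroup_isSimpleGroup [Finite Ω] (hΩ : 3 ≤ Nat.card Ω) (hT : T.IsTree)
    (hF : SimplyTransitive F) (hle : F ≤ F') (hF' : GeneratedByDerivedStabilizers F') (v : V) :
    IsSimpleGroup (evenSubgroup c hT F F' v) := by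
  have := evenSubgroup_infinite (c := c) hΩ hT hF hle v
  refine { exists_pair_ne := exists_pair_ne _, eq_bot_or_eq_top_of_normal := fun N hN => ?_ }
  by_cases h : N = ⊥
  · exact Or.inl h
  refine Or.inr (eq_top_iff.2 fun γ _ => ?_)
  have hinj := evenInclusion_injective (c := c) (F := F) (F' := F') hT v
  have h1 : N.map (evenInclusion c hT F F' v) ≠ ⊥ := fun h' =>
    h ((Subgroup.map_eq_bot_iff_of_injective N hinj).1 h')
  have h2 := typePreservingGroup_le_of_normalized hΩ hT hF hle hF' h1 (v₀ := v) (by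
    rintro g hg _ ⟨n, hn, rfl⟩
    obtain ⟨γ, rfl⟩ := exists_evenInclusion_eq hT hg
    exact ⟨γ * n * γ⁻¹, hN.conj_mem n hn γ, by rw [map_mul, map_mul, map_inv]⟩)
  obtain ⟨n, hn, hnγ⟩ := h2 (evenInclusion_mem hT v γ)
  rwa [← hinj hnγ]

theorem evenSubgroup_hasAsdim [Finite Ω] (hΩ : 3 ≤ Nat.card Ω) (hT : T.IsTree)
    (hF : SimplyTransitive F) (hle : F ≤ F') (v : V) :
    GroupHasAsdim (evenSubgroup c hT F F' v) 1 := by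
  have := evenSubgroup_infinite (c := c) hΩ hT hF hle v
  have : Nonempty Ω := (Finite.card_pos_iff).1 (by omega)
  exact groupHasAsdim_one hT hF (evenSubgroup_fg hT hF hle v (Classical.arbitrary Ω))
    (evenInclusion_injective hT v) fun γ => (evenInclusion_mem hT v γ).1.1

end IndexTwo

/-! ### Automorphisms of finite order -/

section Torsion

variable {V Ω : Type*} {T : SimpleGraph V} {c : LegalColoring T Ω}

open LegalColoring

/-- An automorphism of odd order of a tree fixes the unique median of an orbit. -/
theorem exists_fixed_vertex (c : LegalColoring T Ω) (hT : T.IsTree) {g : T ≃g T} {p : ℕ}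
    (hp : Odd p) (hg : g ^ p = 1) : ∃ v, g v = v := by
  classical
  obtain ⟨v⟩ := hT.connected.nonempty
  -- The sum of the distances to the orbit of `v` is invariant under `g`. The fixed vertex is a
  -- minimum of it.
  let f : V → ℕ := fun u => ∑ i ∈ Finset.range p, (c.wd u ((g ^ i) v)).length
  have hfg : ∀ u, f (g u) = f u := by
    intro u
    have h1 := Finset.sum_range_succ (fun i => (c.wd (g u) ((g ^ i) v)).length) p
    rw [Finset.sum_range_succ', hg, pow_zero] at h1
    refine (Nat.add_right_cancel h1).symm.trans ?_
    refine Finset.sum_congr rfl fun i _ => ?_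
    rw [pow_succ', RelIso.mul_apply, length_wd_map hT]
  let N : V → Ω → Finset ℕ := fun u a =>
    (Finset.range p).filter fun i => (c.wd u ((g ^ i) v)).head? = some a
  have hnb : ∀ u a, f (c.nb u a) + 2 * (N u a).card = f u + p := by
    intro u a
    have h1 : ∀ i ∈ Finset.range p, (c.wd (c.nb u a) ((g ^ i) v)).length +
        2 * (if (c.wd u ((g ^ i) v)).head? = some a then 1 else 0) =
        (c.wd u ((g ^ i) v)).length + 1 := by
      intro i _
      rcases wd_nb_left (c := c) hT u ((g ^ i) v) a with h | ⟨h, h2⟩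
      · rw [h]; simp
      · rw [h, if_neg h2]; simp
    have h2 := Finset.sum_congr rfl h1
    rw [Finset.sum_add_distrib, Finset.sum_add_distrib, ← Finset.mul_sum,
      ← Finset.card_filter] at h2
    simpa using h2
  obtain ⟨u, hu⟩ : ∃ u, ∀ w, f u ≤ f w := by
    obtain ⟨_, ⟨u, rfl⟩, hu⟩ := wellFounded_lt.has_min (Set.range f) ⟨_, v, rfl⟩
    exact ⟨u, fun w => not_lt.1 (hu _ ⟨w, rfl⟩)⟩
  -- Moving along `a` changes `f` by `p - 2 * (N w a).card`. Minimality makes this nonnegative, and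
  -- it is nonzero because `p` is odd.
  have hN : ∀ w a, f w = f u → 2 * (N w a).card < p := by
    intro w a hw
    have h1 := hnb w a
    have h2 := hu (c.nb w a)
    obtain ⟨m, rfl⟩ := hp
    omega
  refine ⟨u, ?_⟩
  by_contra hne
  cases h1 : (c.wd u (g u)).head? with
  | none => rw [List.head?_eq_none_iff, wd_eq_nil hT] at h1; exact hne h1
  | some a =>
  cases h2 : (c.wd (g u) u).head? with
  | none => rw [List.head?_eq_none_iff, wd_eq_nil hT] at h2; exact hne h2.symm
  | some b =>
  -- If `g u ≠ u`, every orbit point lies on the side of `g u` seen from `u` or on the side of `u`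
  -- seen from `g u`. Each side holds fewer than half of the `p` indices, which is impossible.
  have hcover : Finset.range p ⊆ N u a ∪ N (g u) b := by
    intro i hi
    rw [Finset.mem_union]
    by_cases ha : (c.wd u ((g ^ i) v)).head? = some a
    · exact Or.inl (Finset.mem_filter.2 ⟨hi, ha⟩)
    · refine Or.inr (Finset.mem_filter.2 ⟨hi, ?_⟩)
      have h3 : c.wd (g u) ((g ^ i) v) = c.wd (g u) u ++ c.wd u ((g ^ i) v) := by
        refine wd_eq hT (List.isChain_append.2 ⟨wd_isChain hT _ _, wd_isChain hT _ _, ?_⟩) ?_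
        · rw [wd_symm hT u (g u), List.getLast?_reverse, h1]
          intro x hx y hy hxy
          rw [← Option.mem_some_iff.1 hx] at hxy
          subst hxy
          exact ha hy
        · rw [act_append, act_wd hT, act_wd hT]
      rw [h3, List.head?_append, h2]
      rfl
  have h3 := (Finset.card_le_card hcover).trans (Finset.card_union_le _ _)
  rw [Finset.card_range] at h3
  have h4 := hN u a rfl
  have h5 := hN (g u) b (hfg u)
  omega

/-- At a fixed vertex the local permutation has `p`-th power one, but `p` does not divide the
factorial of the degree. It is therefore trivial, and fixedness spreads to all neighbours. -/
theorem eq_one_of_pow_prime_eq_one [Finite Ω] (c : LegalColoring T Ω) (hT : T.IsTree)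
    {g : T ≃g T} {p : ℕ} (hp : p.Prime) (hodd : Odd p) (hΩ : Nat.card Ω < p) (hg : g ^ p = 1) :
    g = 1 := by
  classical
  have := Fintype.ofFinite Ω
  have hperm : ∀ σ : Equiv.Perm Ω, σ ^ p = 1 → σ = 1 := by
    intro σ hσ
    rw [← orderOf_eq_one_iff]
    rcases (Nat.dvd_prime hp).1 (orderOf_dvd_of_pow_eq_one hσ) with h | h
    · exact h
    · have h1 := orderOf_dvd_card (x := σ)
      rw [h, Fintype.card_perm, hp.dvd_factorial, ← Nat.card_eq_fintype_card] at h1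
      omega
  have hloc : ∀ u, g u = u → localPerm c g u = 1 := by
    intro u hu
    apply hperm
    have : ∀ n : ℕ, localPerm c (g ^ n) u = localPerm c g u ^ n := by
      intro n
      induction n with
      | zero => rw [pow_zero, pow_zero, localPerm_one]
      | succ n ih => rw [pow_succ, localPerm_mul, hu, ih, pow_succ]
    rw [← this, hg, localPerm_one]
  obtain ⟨v, hv⟩ := exists_fixed_vertex c hT hodd hg
  refine RelIso.ext fun u => ?_
  change g u = u
  induction u using c.induction_nb hT.connected v with
  | h0 => exact hv
  | h u a ih => rw [c.map_nb, ih, hloc u ih]; rfl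

end Torsion

/-! ### Regular trees -/

section RegularTree

variable (Ω : Type*)

/-- The tree of reduced words in `Ω`: every word is adjacent to the word obtained by deleting its
first letter. -/
def wordTree : SimpleGraph {l : List Ω // l.IsChain (· ≠ ·)} where
  Adj u w := ∃ a, w.1 = a :: u.1 ∨ u.1 = a :: w.1
  symm := ⟨fun _ _ ⟨a, h⟩ => ⟨a, h.symm⟩⟩
  loopless := ⟨fun _ ⟨a, h⟩ => by simp at h⟩

variable {Ω}

theorem wordTree_isTree : (wordTree Ω).IsTree := by
  refine ⟨?_, ?_⟩
  · have key : ∀ (l : List Ω) (hl : l.IsChain (· ≠ ·)),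
        (wordTree Ω).Reachable ⟨l, hl⟩ ⟨[], List.isChain_nil⟩ := by
      intro l
      induction l with
      | nil => exact fun _ => .rfl
      | cons a l ih =>
        intro hl
        have h : (wordTree Ω).Adj ⟨a :: l, hl⟩ ⟨l, hl.tail⟩ := ⟨a, Or.inr rfl⟩
        exact h.reachable.trans (ih _)
    have : Nonempty {l : List Ω // l.IsChain (· ≠ ·)} := ⟨⟨[], List.isChain_nil⟩⟩
    exact ⟨fun u w => (key u.1 u.2).trans (key w.1 w.2).symm⟩
  · rw [SimpleGraph.isAcyclic_iff_forall_adj_isBridge]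
    -- deleting the edge from `u` to `w = a :: u` disconnects the words with suffix `w`
    have key : ∀ (u w : {l : List Ω // l.IsChain (· ≠ ·)}) (a : Ω), w.1 = a :: u.1 →
        (wordTree Ω).IsBridge s(u, w) := by
      intro u w a hw
      rw [SimpleGraph.isBridge_iff]
      rintro ⟨p⟩
      have inv : ∀ x y, ((wordTree Ω).deleteEdges {s(u, w)}).Adj x y → w.1 <:+ y.1 →
          w.1 <:+ x.1 := by
        intro x y hxy hy
        rw [SimpleGraph.deleteEdges_adj] at hxy
        obtain ⟨⟨b, h | h⟩, hne⟩ := hxy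
        · rw [h, List.suffix_cons_iff] at hy
          rcases hy with hy | hy
          · exfalso
            apply hne
            rw [hw] at hy
            have hx : u = x := Subtype.ext (List.cons.inj hy).2
            have hyw : w = y := Subtype.ext (by rw [h, hw, hy])
            rw [hx, hyw]; rfl
          · exact hy
        · rw [h]
          exact hy.trans (List.suffix_cons _ _)
      have walk : ∀ x y, ((wordTree Ω).deleteEdges {s(u, w)}).Walk x y → w.1 <:+ y.1 →
          w.1 <:+ x.1 := by
        intro x y p hy
        induction p with
        | nil => exact hy
        | cons hadj _ ih => exact inv _ _ hadj (ih hy)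
      have := (walk u w p List.suffix_rfl).length_le
      rw [hw] at this
      simp at this
    rintro u w ⟨a, h | h⟩
    · exact key u w a h
    · rw [Sym2.eq_swap]
      exact key w u a h

theorem wordTree_exists_color (e : (wordTree Ω).edgeSet) :
    ∃ a u w, e.1 = s(u, w) ∧ w.1 = a :: u.1 := by
  obtain ⟨e, he⟩ := e
  induction e using Sym2.ind with
  | _ u w =>
    obtain ⟨a, h | h⟩ := he
    · exact ⟨a, u, w, rfl, h⟩
    · exact ⟨a, w, u, Sym2.eq_swap, h⟩

theorem wordTree_color_unique {u w u' w' : {l : List Ω // l.IsChain (· ≠ ·)}} {a a' : Ω}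
    (h : s(u, w) = s(u', w')) (hw : w.1 = a :: u.1) (hw' : w'.1 = a' :: u'.1) : a = a' := by
  rcases Sym2.eq_iff.1 h with ⟨rfl, rfl⟩ | ⟨rfl, rfl⟩
  · rw [hw] at hw'
    exact (List.cons.inj hw').1
  · rw [hw'] at hw
    have := congrArg List.length hw
    simp at this
    omega

/-- The coloring of the edges of the tree of reduced words by the deleted letter. -/
noncomputable def wordTreeColoring (Ω : Type*) : LegalColoring (wordTree Ω) Ω where
  color e := (wordTree_exists_color e).choose
  bijective_star v := by
    have hcol : ∀ e : (wordTree Ω).edgeSet, ∃ u w, e.1 = s(u, w) ∧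
        w.1 = (wordTree_exists_color e).choose :: u.1 :=
      fun e => (wordTree_exists_color e).choose_spec
    constructor
    · rintro ⟨e, he, hve⟩ ⟨f, hf, hvf⟩ hef
      apply Subtype.ext
      obtain ⟨u, w, h1, h2⟩ := hcol ⟨e, he⟩
      obtain ⟨u', w', h1', h2'⟩ := hcol ⟨f, hf⟩
      change e = f
      change e = s(u, w) at h1
      change f = s(u', w') at h1'
      simp only at hef
      rw [hef] at h2
      generalize (wordTree_exists_color ⟨f, hf⟩).choose = a at h2 h2'
      -- Deleting `a` from `v` and prepending `a` to `v` cannot both be edges, since the longer word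
      -- would begin with `a a`.
      have hne : ∀ x y : {l : List Ω // l.IsChain (· ≠ ·)}, v.1 = a :: x.1 → y.1 ≠ a :: v.1 := by
        intro x y hx hy
        have := y.2
        rw [hy, hx] at this
        exact (List.isChain_cons_cons.1 this).1 rfl
      rw [h1] at hve ⊢
      rw [h1'] at hvf ⊢
      rcases Sym2.mem_iff.1 hve with rfl | rfl <;> rcases Sym2.mem_iff.1 hvf with rfl | rfl
      · rw [Subtype.ext (h2.trans h2'.symm)]
      · exact absurd h2 (hne _ _ h2')
      · exact absurd h2' (hne _ _ h2)
      · rw [h2] at h2'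
        rw [Subtype.ext (List.cons.inj h2').2]
    · intro a
      have key : ∀ (u w : {l : List Ω // l.IsChain (· ≠ ·)}) (h : w.1 = a :: u.1),
          v ∈ s(u, w) → ∃ e : (wordTree Ω).incidenceSet v,
            (wordTree_exists_color ⟨e.1, e.2.1⟩).choose = a := by
        intro u w h hv
        have he : s(u, w) ∈ (wordTree Ω).edgeSet := ⟨a, Or.inl h⟩
        refine ⟨⟨s(u, w), he, hv⟩, ?_⟩
        obtain ⟨u', w', h1, h2⟩ := hcol ⟨s(u, w), he⟩
        exact wordTree_color_unique h1.symm h2 h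
      by_cases hv : v.1.head? = some a
      · obtain ⟨l, hl⟩ := v
        cases l with
        | nil => simp at hv
        | cons b l =>
          obtain rfl : b = a := by simpa using hv
          exact key ⟨l, hl.tail⟩ ⟨b :: l, hl⟩ rfl (Sym2.mem_mk_right _ _)
      · exact key v ⟨a :: v.1, List.isChain_cons.2 ⟨fun y hy hay => hv (hay ▸ hy), v.2⟩⟩ rfl
          (Sym2.mem_mk_left _ _)

end RegularTree

/-! ### Alternating groups -/

section Alternating

/-- The group of translations of an additive group. -/
def translationGroup (A : Type*) [AddGroup A] : Subgroup (Equiv.Perm A) where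
  carrier := Set.range Equiv.addLeft
  one_mem' := ⟨0, by ext; simp⟩
  mul_mem' := by
    rintro _ _ ⟨a, rfl⟩ ⟨b, rfl⟩
    exact ⟨a + b, by ext; simp⟩
  inv_mem' := by
    rintro _ ⟨a, rfl⟩
    exact ⟨-a, by rw [eq_inv_iff_mul_eq_one]; ext; simp⟩

theorem translationGroup_simplyTransitive (A : Type*) [AddGroup A] :
    SimplyTransitive (translationGroup A) := by
  intro a b
  refine ⟨Equiv.addLeft (b - a), ⟨⟨_, rfl⟩, by simp⟩, ?_⟩
  rintro _ ⟨⟨d, rfl⟩, h⟩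
  have : d + a = b := h
  rw [← this, add_sub_cancel_right]

theorem addLeft_pow {A : Type*} [AddGroup A] (a : A) (n : ℕ) :
    Equiv.addLeft a ^ n = Equiv.addLeft (n • a) := by
  induction n with
  | zero => ext; simp
  | succ n ih => rw [pow_succ, ih, succ_nsmul]; ext; simp

theorem translationGroup_le_alternatingGroup {A : Type*} [AddGroup A] [Fintype A] [DecidableEq A]
    (hA : Odd (Fintype.card A)) : translationGroup A ≤ alternatingGroup A := by
  rintro _ ⟨a, rfl⟩
  rw [Equiv.Perm.mem_alternatingGroup]
  have h : (Equiv.addLeft a : Equiv.Perm A) ^ Fintype.card A = 1 := by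
    rw [addLeft_pow, card_nsmul_eq_zero]; ext; simp
  have h2 := congrArg Equiv.Perm.sign h
  rw [map_pow, map_one] at h2
  rcases Int.units_eq_one_or (Equiv.Perm.sign (Equiv.addLeft a : Equiv.Perm A)) with h3 | h3
  · exact h3
  · rw [h3, hA.neg_one_pow] at h2
    exact absurd h2 (by decide)

variable {α : Type*} [Fintype α] [DecidableEq α]

open Equiv in
open scoped commutatorElement in
/-- A 3-cycle is a commutator of two permutations supported on two further points. -/
theorem swap_mul_swap_eq_commutator {α : Type*} [DecidableEq α] {x y z u w : α} (hxy : x ≠ y) (hxz : x ≠ z) (hyz : y ≠ z)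
    (hxu : x ≠ u) (hxw : x ≠ w) (hyu : y ≠ u) (hyw : y ≠ w) (hzu : z ≠ u) (hzw : z ≠ w) :
    swap x y * swap x z = ⁅swap x y * swap u w, swap x y * swap x z⁆ := by
  set g : Perm α := swap x y * swap u w with hg
  have gx : g x = y := by simp [hg, Perm.mul_apply, swap_apply_of_ne_of_ne hxu hxw]
  have gy : g y = x := by simp [hg, Perm.mul_apply, swap_apply_of_ne_of_ne hyu hyw]
  have gz : g z = z := by
    simp [hg, Perm.mul_apply, swap_apply_of_ne_of_ne hzu hzw, swap_apply_of_ne_of_ne hxz.symm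
      hyz.symm]
  have h1 := swap_apply_apply g x y
  have h2 := swap_apply_apply g x z
  rw [gx, gy] at h1
  rw [gx, gz] at h2
  have h3 := swap_apply_apply (swap x y) x z
  rw [swap_apply_left, swap_apply_of_ne_of_ne hxz.symm hyz.symm] at h3
  have h4 := swap_apply_apply (swap x z) x y
  rw [swap_apply_left, swap_apply_of_ne_of_ne hxy.symm hyz, swap_comm z y] at h4
  have h5 : g * (swap x y * swap x z) * g⁻¹ = swap x y * swap y z := by
    calc g * (swap x y * swap x z) * g⁻¹ = (g * swap x y * g⁻¹) * (g * swap x z * g⁻¹) := by group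
      _ = swap x y * swap y z := by rw [← h1, ← h2, swap_comm y x]
  rw [commutatorElement_def, h5, mul_inv_rev, swap_inv, swap_inv]
  rw [swap_inv] at h3 h4
  calc swap x y * swap x z = swap x z * (swap x z * swap x y * swap x z) * 1 := by
        rw [mul_one, ← mul_assoc, ← mul_assoc, swap_mul_self, one_mul]
    _ = swap x z * (swap x y * swap x z * swap x y) * 1 := by rw [← h4, h3]
    _ = swap x y * swap y z * (swap x z * swap x y) := by
        rw [h3, mul_one]
        simp only [← mul_assoc, swap_mul_self, one_mul]

/-- Three-cycles generate. Each is a commutator of even permutations of five points, and a sixth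
point is left over to be fixed by both; hence the bound on the degree. -/
theorem alternatingGroup_generatedByDerivedStabilizers (hα : 6 ≤ Fintype.card α) :
    GeneratedByDerivedStabilizers (alternatingGroup α) := by
  refine le_antisymm ?_ (iSup_le fun a => ?_)
  · conv_lhs => rw [← Equiv.Perm.closure_three_cycles_eq_alternating]
    rw [Subgroup.closure_le]
    intro t ht
    obtain ⟨f⟩ : Nonempty (Fin 6 ↪ α) := Function.Embedding.nonempty_of_card_le (by simpa using hα)
    have hne : ∀ i j, i ≠ j → f i ≠ f j := fun i j h => f.injective.ne h
    have h1 : Equiv.Perm.IsThreeCycle (Equiv.swap (f 0) (f 1) * Equiv.swap (f 0) (f 2)) :=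
      Equiv.Perm.isThreeCycle_swap_mul_swap_same (hne _ _ (by decide)) (hne _ _ (by decide))
        (hne _ _ (by decide))
    obtain ⟨π, hπ⟩ := isConj_iff.1 (Equiv.Perm.isConj_iff_cycleType_eq.2 (h1.trans ht.symm))
    have hne' : ∀ i j, i ≠ j → π (f i) ≠ π (f j) := fun i j h => π.injective.ne (hne i j h)
    have h2 : t = Equiv.swap (π (f 0)) (π (f 1)) * Equiv.swap (π (f 0)) (π (f 2)) := by
      rw [← hπ, Equiv.swap_apply_apply, Equiv.swap_apply_apply]; group
    have hstab : ∀ i j k l : Fin 6, i ≠ j → k ≠ l → 5 ≠ i → 5 ≠ j → 5 ≠ k → 5 ≠ l →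
        Equiv.swap (π (f i)) (π (f j)) * Equiv.swap (π (f k)) (π (f l)) ∈
          pointStabilizer (alternatingGroup α) (π (f 5)) := by
      intro i j k l hij hkl hi hj hk hl
      refine ⟨?_, ?_⟩
      · change _ ∈ alternatingGroup α
        rw [Equiv.Perm.mem_alternatingGroup, map_mul, Equiv.Perm.sign_swap (hne' _ _ hij),
          Equiv.Perm.sign_swap (hne' _ _ hkl)]
        rfl
      · change (Equiv.swap _ _ * Equiv.swap _ _ : Equiv.Perm α) (π (f 5)) = π (f 5)
        rw [Equiv.Perm.mul_apply, Equiv.swap_apply_of_ne_of_ne (hne' _ _ hk) (hne' _ _ hl),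
          Equiv.swap_apply_of_ne_of_ne (hne' _ _ hi) (hne' _ _ hj)]
    rw [h2, swap_mul_swap_eq_commutator (hne' 0 1 (by decide)) (hne' 0 2 (by decide))
      (hne' 1 2 (by decide)) (hne' 0 3 (by decide)) (hne' 0 4 (by decide)) (hne' 1 3 (by decide))
      (hne' 1 4 (by decide)) (hne' 2 3 (by decide)) (hne' 2 4 (by decide))]
    exact Subgroup.mem_iSup_of_mem (π (f 5)) (Subgroup.commutator_mem_commutator
      (hstab 0 1 3 4 (by decide) (by decide) (by decide) (by decide) (by decide) (by decide))
      (hstab 0 1 0 2 (by decide) (by decide) (by decide) (by decide) (by decide) (by decide)))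
  · rw [Subgroup.commutator_le]
    intro g hg h hh
    exact Subgroup.mul_mem _ (Subgroup.mul_mem _ (Subgroup.mul_mem _ hg.1 hh.1)
      (Subgroup.inv_mem _ hg.1)) (Subgroup.inv_mem _ hh.1)

/-- The alternating group of odd prime degree is generated by a translation and a 3-cycle. -/
theorem closure_addLeft_threeCycle {p : ℕ} [NeZero p] (hp : p.Prime) (hodd : Odd p)
    {t : Equiv.Perm (Fin p)} (ht : t.IsThreeCycle) :
    Subgroup.closure {Equiv.addLeft 1, t} = alternatingGroup (Fin p) := by
  have h1 : (Equiv.addLeft (1 : Fin p) : Equiv.Perm (Fin p)) ∈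
      Subgroup.closure {Equiv.addLeft 1, t} := Subgroup.subset_closure (by simp)
  apply le_antisymm
  · rw [Subgroup.closure_le]
    rintro σ (rfl | rfl)
    · exact translationGroup_le_alternatingGroup (by simpa using hodd) ⟨1, rfl⟩
    · exact ht.mem_alternatingGroup
  · have : MulAction.IsPretransitive (Subgroup.closure {Equiv.addLeft 1, t}) (Fin p) := by
      refine ⟨fun x y => ?_⟩
      refine ⟨⟨Equiv.addLeft 1 ^ (y - x).val, Subgroup.pow_mem _ h1 _⟩, ?_⟩
      change (Equiv.addLeft (1 : Fin p) ^ (y - x).val : Equiv.Perm (Fin p)) x = y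
      have h2 : ∀ n : ℕ, (n • (1 : Fin p)).val = n % p := by
        intro n
        induction n with
        | zero => simp
        | succ n ih => rw [succ_nsmul, Fin.val_add, ih, Fin.val_one', ← Nat.add_mod]
      have h3 : (y - x).val • (1 : Fin p) = y - x :=
        Fin.ext (by rw [h2, Nat.mod_eq_of_lt (y - x).isLt])
      rw [addLeft_pow, h3]
      exact sub_add_cancel y x
    -- Jordan's theorem: a transitive group of prime degree is primitive, and a primitive group
    -- containing a 3-cycle contains the alternating group.
    exact Equiv.Perm.alternatingGroup_le_of_isPreprimitive_of_isThreeCycle_mem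
      (MulAction.IsPreprimitive.of_prime_card (by simpa using hp)) ht
      (Subgroup.subset_closure (by simp))

end Alternating

/-! ### Distinguishing the groups by torsion, and the main theorem -/

/-- For an odd prime `q > p`, the type-preserving group of degree `q` contains elements of order
`q`, unlike the one of degree `p`. -/
theorem isEmpty_mulEquiv_of_lt {p q : ℕ} [NeZero q] (hq : q.Prime) (hodd : Odd q) (hpq : p < q)
    {v : {l : List (Fin p) // l.IsChain (· ≠ ·)}} {w : {l : List (Fin q) // l.IsChain (· ≠ ·)}}
    {E E' : Subgroup (Equiv.Perm (Fin p))} {F F' : Subgroup (Equiv.Perm (Fin q))}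
    (hF : F = translationGroup (Fin q)) (hle : F ≤ F') :
    IsEmpty (evenSubgroup (wordTreeColoring (Fin p)) wordTree_isTree E E' v ≃*
      evenSubgroup (wordTreeColoring (Fin q)) wordTree_isTree F F' w) := by
  refine ⟨fun e => ?_⟩
  have hst : SimplyTransitive F := hF ▸ translationGroup_simplyTransitive (Fin q)
  have h1 : (Equiv.addLeft 1 : Equiv.Perm (Fin q)) ∈ F' := hle (hF ▸ ⟨1, rfl⟩)
  -- The lift of the translation by 1 inherits its order `q`, since `vertexHom` is injective.
  obtain ⟨k, hk, hk1⟩ := exists_mem_vertexGroup (c := wordTreeColoring (Fin q)) (F := F)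
    wordTree_isTree hst w h1
  have hkq : k ^ q = 1 := by
    have h2 : (⟨k, hk⟩ : vertexGroup (wordTreeColoring (Fin q)) F F' w) ^ q = 1 := by
      apply vertexHom_injective wordTree_isTree hst w
      rw [map_pow, map_one]
      change localPerm _ k w ^ q = 1
      have h3 : q • (1 : Fin q) = 0 := by
        simpa using card_nsmul_eq_zero (G := Fin q) (x := 1)
      rw [hk1, addLeft_pow, h3]
      ext; simp
    exact congrArg Subtype.val h2
  obtain ⟨γ, hγ⟩ := exists_evenInclusion_eq wordTree_isTree
    (vertexGroup_le_typePreservingGroup wordTree_isTree hle w w hk)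
  have hγq : γ ^ q = 1 := by
    apply evenInclusion_injective wordTree_isTree w
    rw [map_pow, hγ, hkq, map_one]
  have h4 := eq_one_of_pow_prime_eq_one (wordTreeColoring (Fin p)) wordTree_isTree hq hodd
    (by simpa using hpq) (g := evenInclusion _ _ _ _ _ (e.symm γ))
    (by rw [← map_pow, ← map_pow, hγq, map_one, map_one])
  have h5 : e.symm γ = 1 := evenInclusion_injective wordTree_isTree v (h4.trans (map_one _).symm)
  have h6 : γ = 1 := by simpa using h5
  rw [← hγ, h6, map_one, localPerm_one] at hk1
  have h7 : (0 : Fin q) = 1 + 0 := DFunLike.congr_fun hk1 0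
  have h8 := congrArg Fin.val h7
  rw [add_zero, Fin.val_zero, Fin.val_one', Nat.mod_eq_of_lt hq.one_lt] at h8
  exact zero_ne_one h8

theorem mainTheorem3 :
    (∀ (Ω : Type*) [Finite Ω] (_ : 3 ≤ Nat.card Ω)
      (V : Type*) (T : SimpleGraph V) (_ : T.IsTree) (c : LegalColoring T Ω)
      (F F' : Subgroup (Equiv.Perm Ω)) (_ : F ≤ F')
      (_ : SimplyTransitive F) (_ : GeneratedByDerivedStabilizers F'),
      ∃ H : Subgroup (restrictedUniversalGroup c F F'),
        H.index = 2 ∧ IsSimpleGroup H ∧ Group.FG H ∧ GroupHasAsdim H 1) ∧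
    (∃ (d : ℕ → ℕ) (V : ℕ → Type) (T : ∀ n, SimpleGraph (V n))
      (c : ∀ n, LegalColoring (T n) (Fin (d n)))
      (F F' : ∀ n, Subgroup (Equiv.Perm (Fin (d n))))
      (H : ∀ n, Subgroup (restrictedUniversalGroup (c n) (F n) (F' n))),
      (∀ n, 3 ≤ d n ∧ (T n).IsTree ∧ F n ≤ F' n ∧
        SimplyTransitive (F n) ∧ GeneratedByDerivedStabilizers (F' n) ∧
        (H n).index = 2 ∧ IsSimpleGroup (H n) ∧ GroupHasAsdim (H n) 1 ∧
        ∃ s : Fin 4 → H n, Subgroup.closure (Set.range s) = ⊤) ∧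
      ∀ m n, m ≠ n → IsEmpty (H m ≃* H n)) := by
  constructor
  · intro Ω _ hΩ V T hT c F F' hle hF hF'
    obtain ⟨v⟩ := hT.connected.nonempty
    obtain ⟨a⟩ : Nonempty Ω := Finite.card_pos_iff.1 (by omega)
    exact ⟨evenSubgroup c hT F F' v, evenSubgroup_index hT hF hle v a,
      evenSubgroup_isSimpleGroup hΩ hT hF hle hF' v, evenSubgroup_fg hT hF hle v a,
      evenSubgroup_hasAsdim hΩ hT hF hle v⟩
  · let d : ℕ → ℕ := fun n => Nat.nth Nat.Prime (n + 3)
    have hd : ∀ n, (d n).Prime := fun n => Nat.prime_nth_prime _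
    have hmono : StrictMono d := fun m n h =>
      Nat.nth_strictMono Nat.infinite_setOfPred_prime (Nat.add_lt_add_right h 3)
    have h7 : ∀ n, 6 ≤ d n := by
      intro n
      have h1 := (Nat.nth_strictMono Nat.infinite_setOfPred_prime).add_le_nat (n + 1) 2
      change n + 1 + Nat.nth Nat.Prime 2 ≤ d n at h1
      have h2 : Nat.nth Nat.Prime 2 = 5 := Nat.nth_prime_two_eq_five
      omega
    have hne : ∀ n, NeZero (d n) := fun n => ⟨(hd n).ne_zero⟩
    have hodd : ∀ n, Odd (d n) := fun n => (hd n).odd_of_ne_two (by have := h7 n; omega)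
    have hle : ∀ n, translationGroup (Fin (d n)) ≤ alternatingGroup (Fin (d n)) :=
      fun n => translationGroup_le_alternatingGroup (by simpa using hodd n)
    have hst := fun n => translationGroup_simplyTransitive (Fin (d n))
    have hgen : ∀ n, GeneratedByDerivedStabilizers (alternatingGroup (Fin (d n))) :=
      fun n => alternatingGroup_generatedByDerivedStabilizers (by simpa using h7 n)
    have hcard : ∀ n, 3 ≤ Nat.card (Fin (d n)) := fun n => by
      have := h7 n
      simp only [Nat.card_eq_fintype_card, Fintype.card_fin]
      omega
    let v : ∀ n, {l : List (Fin (d n)) // l.IsChain (· ≠ ·)} := fun n => ⟨[], List.isChain_nil⟩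
    refine ⟨d, fun n => {l : List (Fin (d n)) // l.IsChain (· ≠ ·)}, fun n => wordTree (Fin (d n)),
      fun n => wordTreeColoring (Fin (d n)), fun n => translationGroup (Fin (d n)),
      fun n => alternatingGroup (Fin (d n)),
      fun n => evenSubgroup (wordTreeColoring (Fin (d n))) wordTree_isTree _ _ (v n), fun n => ?_,
      fun m n hmn => ?_⟩
    · refine ⟨le_trans (by norm_num) (h7 n), wordTree_isTree, hle n, hst n, hgen n,
        evenSubgroup_index wordTree_isTree (hst n) (hle n) (v n) 0,
        evenSubgroup_isSimpleGroup (hcard n) wordTree_isTree (hst n) (hle n) (hgen n) (v n),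
        evenSubgroup_hasAsdim (hcard n) wordTree_isTree (hst n) (hle n) (v n), ?_⟩
      obtain ⟨f⟩ : Nonempty (Fin 3 ↪ Fin (d n)) :=
        Function.Embedding.nonempty_of_card_le (by have := h7 n; simp; omega)
      have ht := Equiv.Perm.isThreeCycle_swap_mul_swap_same (a := f 0) (b := f 1) (c := f 2)
        (f.injective.ne (by decide)) (f.injective.ne (by decide)) (f.injective.ne (by decide))
      exact evenSubgroup_four_generators wordTree_isTree (hst n) (hle n) (v n) 0
        (closure_addLeft_threeCycle (hd n) (hodd n) ht)
    · rcases lt_or_gt_of_ne hmn with h | h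
      · exact isEmpty_mulEquiv_of_lt (hd n) (hodd n) (hmono h) rfl (hle n)
      · refine ⟨fun e => ?_⟩
        exact (isEmpty_mulEquiv_of_lt (hd m) (hodd m) (hmono h) rfl (hle m)).false e.symm
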